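/- Let $\Pi_n$ be the space of real polynomials in two variables of total degree at most $n$. A finite set $\mathcal X\subset\mathbb R^2$ is *$n$-poised* if for all prescribed values at the points (nodes) of $\mathcal X$ there is a unique $p\in\Pi_n$ taking these values. The *fundamental polynomial* $p_A^\star$ of a node $A\in\mathcal X$ is then the polynomial in $\Pi_n$ that equals $1$ at $A$ and $0$ at all other nodes. A *$GC_n$ set* is an $n$-poised set in which the fundamental polynomial of each node is a product of $n$ linear factors (polynomials of degree $1$). A *$k$-node line* is a line passing through exactly $k$ nodes of $\mathcal X$, and a *maximal line* of a $GC_n$ set is an $(n+1)$-node line. A node $A\in\mathcal X$ *uses* a line $\ell$ if $p_A^\star=\ell q$ with $q\in\Pi_{n-1}$, where $\ell$ also denotes a polynomial of degree $1$ defining the line; $\mathcal X_\ell$ is the set of nodes of $\mathcal X$ that use $\ell$. The *Gasca–Maeztu conjecture for the degree $k$* says that every $GC_k$ set has a maximal line. **Theorem.** Let $n\ge 1$, $n\ne 3$, and assume that the Gasca–Maeztu conjecture holds for all degrees $k$ with $1\le k\le n$. Let $\mathcal X$ be a $GC_n$ set and let $\ell$ be an $n$-node line of $\mathcal X$. Then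 $$|\mathcal X_\ell|=\binom n2\quad\text{or}\quad|\mathcal X_\ell|=\binom{n-1}2 .$$ Moreover: (i) $|\mathcal X_\ell|=\binom n2$ if and only if there is a maximal line $M_0$ such that $M_0\cap\ell\cap\mathcal X=\emptyset$. For every such $M_0$ we have $\mathcal X_\ell=\mathcal X\setminus(\ell\cup M_0)$, and, if $n\ge2$, $\mathcal X_\ell$ is a $GC_{n-2}$ set. (ii) $|\mathcal X_\ell|=\binom{n-1}2$ if and only if there are two distinct maximal lines $M',M''$ such that $M'\cap M''\cap\ell$ is a node of $\mathcal X$. For all such $M',M''$ we have $\mathcal X_\ell=\mathcal X\setminus(\ell\cup M'\cup M'')$, and, if $n\ge3$, $\mathcal X_\ell$ is a $GC_{n-3}$ set. -/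

import Mathlib

namespace GCSets

/-- Points (nodes) of the real plane, given by their two coordinates. -/
abbrev Plane : Type := Fin 2 → ℝ

/-- Real polynomials in two variables; `Π_n` consists of those of total degree at most `n`. -/
abbrev BiPoly : Type := MvPolynomial (Fin 2) ℝ

/-- The zero set of a bivariate polynomial. -/
def zeros (p : BiPoly) : Set Plane := {P | MvPolynomial.eval P p = 0}

/-- A line: the zero set of a polynomial of degree one. -/
def IsLine (L : Set Plane) : Prop :=
  ∃ l : BiPoly, l.totalDegree = 1 ∧ L = zeros l

/-- `X` is `n`-poised: every Lagrange interpolation problem on `X` has a unique solution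
of total degree at most `n`. Only the values of `c` on `X` matter. -/
def IsPoised (n : ℕ) (X : Finset Plane) : Prop :=
  ∀ c : Plane → ℝ, ∃! p : BiPoly,
    p.totalDegree ≤ n ∧ ∀ A ∈ X, MvPolynomial.eval A p = c A

/-- `p` is an `n`-fundamental polynomial of the node `A` with respect to `X`. -/
def IsFundamental (n : ℕ) (X : Finset Plane) (A : Plane) (p : BiPoly) : Prop :=
  p.totalDegree ≤ n ∧ MvPolynomial.eval A p = 1 ∧
    ∀ B ∈ X, B ≠ A → MvPolynomial.eval B p = 0

/-- `X` is a `GC_n` set: it is `n`-poised, and the fundamental polynomial of each node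
is a product of `n` linear factors. -/
def IsGC (n : ℕ) (X : Finset Plane) : Prop :=
  IsPoised n X ∧ ∀ A ∈ X, ∀ p : BiPoly, IsFundamental n X A p →
    ∃ f : Fin n → BiPoly, (∀ i, (f i).totalDegree = 1) ∧ p = ∏ i, f i

/-- `L` is a `k`-node line of `X`: a line that passes through exactly `k` nodes of `X`. -/
def IsNodeLine (k : ℕ) (X : Finset Plane) (L : Set Plane) : Prop :=
  IsLine L ∧ ((X : Set Plane) ∩ L).ncard = k

/-- A maximal line (with respect to the degree `n`): an `(n+1)`-node line. -/
def IsMaximalLine (n : ℕ) (X : Finset Plane) (M : Set Plane) : Prop :=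
  IsNodeLine (n + 1) X M

/-- The Gasca–Maeztu conjecture for the degree `n`. -/
def GascaMaeztu (n : ℕ) : Prop :=
  ∀ X : Finset Plane, IsGC n X → ∃ M : Set Plane, IsMaximalLine n X M

/-- The node `A` uses the line `L`: its fundamental polynomial is `l * q`, where `l` is a
linear polynomial defining `L` and `q` has total degree at most `n - 1`. -/
def Uses (n : ℕ) (X : Finset Plane) (A : Plane) (L : Set Plane) : Prop :=
  ∃ p l q : BiPoly, IsFundamental n X A p ∧ l.totalDegree = 1 ∧ L = zeros l ∧
    q.totalDegree + 1 ≤ n ∧ p = l * q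

open Classical in
/-- The set `X_L` of the nodes of `X` that use the line `L`. -/
noncomputable def users (n : ℕ) (X : Finset Plane) (L : Set Plane) : Finset Plane :=
  X.filter (fun A => Uses n X A L)

end GCSets

namespace GCSets

open MvPolynomial
open scoped Classical

/-! A polynomial with more zeros on a line than its degree is divisible by the line
(`dvd_of_zeros`). Hence removing a maximal line lowers the degree of a GC set by one, two maximal
lines share a node, and in positive degree no three are concurrent. The same division, applied to
fundamental polynomials, determines the users of `L` as soon as a maximal line has no node on `L`,
or two maximal lines meet at a node of `L`. What remains is `dichotomy`: one of these configurations
occurs.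

The key is `IsGC.eq_of_disjoint_maximalLine`: at most one maximal line of `X \ M` has no node on
`M`. If there were two, meeting at a node `B`, the fundamental polynomial of each node on `M` would
have prescribed zeros on both. This fixes, on either line, the ratio of its second to its first
Taylor coefficient at `B`. Having a linear factor through `B`, it then satisfies one fixed linear
relation on its derivatives at `B`. The relation extends to every polynomial of admissible degree
vanishing off `M`, but fails for a suitable multiple of the product of the two lines.

By induction every GC set of positive degree has three maximal lines. If `Dichotomy` fails, they cut
`L` in three different nodes, which settles `n ≤ 2`. The induction step (`dichotomy_succ`) peels off
maximal lines until `L` itself is maximal and concurrent with two others. Degree 3 is excluded, so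
the induction restarts at 4, where the three nodes off three maximal lines form a triangle and
incidences with its sides are contradictory (`false_of_sides_miss`). -/

/-! ### Linear polynomials, restriction to a line, divisibility -/

theorem exists_coeffs_of_totalDegree_eq_one {l : BiPoly} (hl : l.totalDegree = 1) :
    ∃ a b c : ℝ, (a ≠ 0 ∨ b ≠ 0) ∧ l = C a * X 0 + C b * X 1 + C c := by
  have key : l = C (l.coeff (Finsupp.single 0 1)) * X 0 + C (l.coeff (Finsupp.single 1 1)) * X 1
      + C (l.coeff 0) := by
    ext d
    by_cases hd : 1 < d.degree
    · have h0 : l.coeff d = 0 := by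
        apply coeff_eq_zero_of_totalDegree_lt
        rw [hl]; exact hd
      have h1 : Finsupp.single (0 : Fin 2) 1 ≠ d := by
        rintro rfl; simp at hd
      have h2 : Finsupp.single (1 : Fin 2) 1 ≠ d := by
        rintro rfl; simp at hd
      have h3 : 0 ≠ d := by
        rintro rfl; simp at hd
      simp [h0, coeff_X, h1, h2, coeff_C, h3]
    · have hd' : d 0 + d 1 ≤ 1 := by
        have := not_lt.1 hd
        simpa [Finsupp.degree_eq_sum] using this
      have hcases : d = 0 ∨ d = Finsupp.single 0 1 ∨ d = Finsupp.single 1 1 := by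
        have : (d 0 = 0 ∧ d 1 = 0) ∨ (d 0 = 1 ∧ d 1 = 0) ∨ (d 0 = 0 ∧ d 1 = 1) := by omega
        rcases this with h | h | h
        · left; ext i; fin_cases i <;> simp [h.1, h.2]
        · right; left; ext i; fin_cases i <;> simp [h.1, h.2]
        · right; right; ext i; fin_cases i <;> simp [h.1, h.2]
      have e01 : Finsupp.single (0 : Fin 2) 1 ≠ Finsupp.single (1 : Fin 2) 1 := by
        intro h; have := DFunLike.congr_fun h 0; simp at this
      rcases hcases with rfl | rfl | rfl
      · simp [coeff_X]
      · simp [coeff_X, coeff_C, e01.symm, eq_comm]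
      · simp [coeff_X, coeff_C, e01, eq_comm]
  refine ⟨_, _, _, ?_, key⟩
  by_contra! h
  rw [h.1, h.2] at key
  rw [key] at hl
  simp at hl

theorem eval_linear (a b c : ℝ) (P : Plane) :
    eval P (C a * X 0 + C b * X 1 + C c : BiPoly) = a * P 0 + b * P 1 + c := by
  simp

theorem totalDegree_linear {a b : ℝ} (c : ℝ) (h : a ≠ 0 ∨ b ≠ 0) :
    (C a * X 0 + C b * X 1 + C c : BiPoly).totalDegree = 1 := by
  apply le_antisymm
  · refine (totalDegree_add _ _).trans (max_le ((totalDegree_add _ _).trans (max_le ?_ ?_)) ?_)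
    · exact (totalDegree_mul _ _).trans (by simp)
    · exact (totalDegree_mul _ _).trans (by simp)
    · simp
  · by_contra! hlt
    obtain ⟨r, hr⟩ : ∃ r, (C a * X 0 + C b * X 1 + C c : BiPoly) = C r :=
      ⟨_, totalDegree_eq_zero_iff_eq_C.1 (by omega)⟩
    have h0 := congrArg (eval (![0, 0] : Plane)) hr
    have h1 := congrArg (eval (![1, 0] : Plane)) hr
    have h2 := congrArg (eval (![0, 1] : Plane)) hr
    simp at h0 h1 h2
    rcases h with h | h
    · exact h (by linarith)
    · exact h (by linarith)

/-- Restriction of a bivariate polynomial to the parametrized line `t ↦ A + t • v`. -/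
noncomputable def lineHom (A v : Plane) : BiPoly →ₐ[ℝ] Polynomial ℝ :=
  aeval fun i => Polynomial.C (A i) + Polynomial.C (v i) * Polynomial.X

theorem eval_lineHom (A v : Plane) (p : BiPoly) (t : ℝ) :
    (lineHom A v p).eval t = eval (A + t • v) p := by
  have : (Polynomial.aeval t).comp (lineHom A v) = aeval (A + t • v) := by
    apply MvPolynomial.algHom_ext
    intro i
    simp [lineHom]; ring
  have h := DFunLike.congr_fun this p
  rw [AlgHom.comp_apply, Polynomial.coe_aeval_eq_eval] at h
  simpa [aeval_eq_eval] using h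

theorem natDegree_lineHom_le (A v : Plane) (p : BiPoly) :
    (lineHom A v p).natDegree ≤ p.totalDegree := by
  have := MvPolynomial.aeval_natDegree_le (n := 1) p le_rfl
    (fun i => Polynomial.C (A i) + Polynomial.C (v i) * Polynomial.X) (fun i => by compute_degree)
  simpa [lineHom] using this

/-- A direction vector for the zero set of a polynomial of degree one. -/
theorem exists_direction {l : BiPoly} (hl : l.totalDegree = 1) :
    ∃ v : Plane, v ≠ 0 ∧ (∀ A : Plane, ∀ t : ℝ, eval (A + t • v) l = eval A l) ∧
      ∀ B ∈ zeros l, (∀ Z ∈ zeros l, ∃ t : ℝ, Z = B + t • v) ∧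
        ∀ p : BiPoly, lineHom B v p = 0 → l ∣ p := by
  obtain ⟨a, b, c, hab, rfl⟩ := exists_coeffs_of_totalDegree_eq_one hl
  have hN : a ^ 2 + b ^ 2 ≠ 0 := by
    rcases hab with h | h <;> positivity
  refine ⟨![b, -a], ?_, ?_, ?_⟩
  · intro h
    have h0 := congrFun h 0
    have h1 := congrFun h 1
    simp at h0 h1
    tauto
  · intro A t; rw [eval_linear, eval_linear]; simp; ring
  · intro B hB
    simp only [zeros, Set.mem_ofPred_eq, eval_linear] at hB
    constructor
    · intro Z hZ
      simp only [zeros, Set.mem_ofPred_eq, eval_linear] at hZ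
      refine ⟨(b * (Z 0 - B 0) - a * (Z 1 - B 1)) / (a ^ 2 + b ^ 2), ?_⟩
      ext i
      fin_cases i
      · simp; field_simp; linear_combination a * (hZ - hB)
      · simp; field_simp; linear_combination b * (hZ - hB)
    · intro p hp
      set l : BiPoly := C a * X 0 + C b * X 1 + C c with hldef
      rw [← Ideal.mem_span_singleton, ← Ideal.Quotient.eq_zero_iff_mem]
      -- `s` is the affine coordinate along the line with origin `B`. Modulo `l` each variable
      -- equals its restriction evaluated at `s`, so reduction modulo `l` factors through the
      -- restriction.
      let s : BiPoly := C (b / (a ^ 2 + b ^ 2)) * (X 0 - C (B 0)) -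
        C (a / (a ^ 2 + b ^ 2)) * (X 1 - C (B 1))
      let π := Ideal.Quotient.mkₐ ℝ (Ideal.span {l})
      have hcomp : π = (π.comp (Polynomial.aeval s)).comp (lineHom B ![b, -a]) := by
        apply MvPolynomial.algHom_ext
        intro i
        change π (X i) = π (Polynomial.aeval s (lineHom B ![b, -a] (X i)))
        rw [← sub_eq_zero, ← map_sub]
        apply Ideal.Quotient.eq_zero_iff_mem.2
        rw [Ideal.mem_span_singleton]
        have e1 : (C (b / (a ^ 2 + b ^ 2)) * C b + C (a / (a ^ 2 + b ^ 2)) * C a : BiPoly) = 1 := by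
          rw [← C_mul, ← C_mul, ← C_add, ← C_1]; congr 1; field_simp; ring
        have e3 : (C c : BiPoly) = - (C a * C (B 0)) - C b * C (B 1) := by
          rw [← C_mul, ← C_mul, ← C_neg, ← C_sub]; congr 1; linarith
        fin_cases i
        · refine ⟨C (a / (a ^ 2 + b ^ 2)), ?_⟩
          simp only [lineHom, aeval_X, map_add, map_mul, Polynomial.aeval_C, Polynomial.aeval_X, s,
            hldef, e3, algebraMap_eq]
          simp
          linear_combination -(X 0 - C (B 0)) * e1
        · refine ⟨C (b / (a ^ 2 + b ^ 2)), ?_⟩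
          simp only [lineHom, aeval_X, map_add, map_mul, Polynomial.aeval_C, Polynomial.aeval_X, s,
            hldef, e3, algebraMap_eq]
          simp
          linear_combination -(X 1 - C (B 1)) * e1
      have h := DFunLike.congr_fun hcomp p
      simp only [AlgHom.comp_apply, hp, map_zero] at h
      exact h

theorem ne_zero_of_totalDegree_eq_one {l : BiPoly} (hl : l.totalDegree = 1) : l ≠ 0 := by
  rintro rfl; simp at hl

theorem prime_of_totalDegree_eq_one {l : BiPoly} (hl : l.totalDegree = 1) : Prime l := by
  refine (irreducible_of_totalDegree_eq_one hl fun x hx => ?_).prime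
  rw [isUnit_iff_ne_zero]
  rintro rfl
  refine ne_zero_of_totalDegree_eq_one hl ?_
  ext d
  simpa using hx d

theorem eval_eq_zero_of_dvd {l p : BiPoly} (h : l ∣ p) {A : Plane} (hA : A ∈ zeros l) :
    eval A p = 0 := by
  obtain ⟨q, rfl⟩ := h
  have : eval A l = 0 := hA
  simp [this]

/-- A polynomial with more zeros on a line than its degree is divisible by the line. -/
theorem dvd_of_zeros {l : BiPoly} (hl : l.totalDegree = 1) {p : BiPoly} {S : Finset Plane}
    (hS : ∀ A ∈ S, A ∈ zeros l ∧ eval A p = 0) (hp : p.totalDegree < S.card) : l ∣ p := by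
  classical
  obtain ⟨v, hv, -, h⟩ := exists_direction hl
  obtain ⟨B, hB⟩ : S.Nonempty := Finset.card_pos.1 (by omega)
  obtain ⟨hpar, hdvd⟩ := h B (hS B hB).1
  apply hdvd
  choose! t ht using hpar
  have hinj : Set.InjOn t S := by
    intro x hx y hy hxy
    rw [ht x (hS x hx).1, ht y (hS y hy).1, hxy]
  apply Polynomial.eq_zero_of_natDegree_lt_card_of_eval_eq_zero' _ (S.image t)
  · intro i hi
    obtain ⟨A, hA, rfl⟩ := Finset.mem_image.1 hi
    rw [eval_lineHom, ← ht A (hS A hA).1]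
    exact (hS A hA).2
  · rw [Finset.card_image_of_injOn hinj]
    exact (natDegree_lineHom_le _ _ _).trans_lt hp

theorem totalDegree_of_eq_mul {l p q : BiPoly} (hl : l.totalDegree = 1) (hp : p ≠ 0)
    (h : p = l * q) : p.totalDegree = q.totalDegree + 1 := by
  rw [h, totalDegree_mul_of_isDomain (ne_zero_of_totalDegree_eq_one hl), hl, add_comm]
  rintro rfl; simp [h] at hp

theorem IsLine.eq_of_mem {L L' : Set Plane} (hL : IsLine L) (hL' : IsLine L') {A B : Plane}
    (hAB : A ≠ B) (hA : A ∈ L) (hB : B ∈ L) (hA' : A ∈ L') (hB' : B ∈ L') : L = L' := by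
  classical
  have key : ∀ l l' : BiPoly, l.totalDegree = 1 → l'.totalDegree = 1 → A ∈ zeros l → B ∈ zeros l →
      A ∈ zeros l' → B ∈ zeros l' → zeros l ⊆ zeros l' := by
    intro l l' hl hl' h1 h2 h3 h4
    have hd : l ∣ l' := by
      apply dvd_of_zeros hl (S := {A, B})
      · intro Z hZ
        rcases Finset.mem_insert.1 hZ with rfl | hZ
        · exact ⟨h1, h3⟩
        · rw [Finset.mem_singleton.1 hZ]; exact ⟨h2, h4⟩
      · rw [hl', Finset.card_pair hAB]; norm_num
    exact fun Z hZ => eval_eq_zero_of_dvd hd hZ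
  obtain ⟨l, hl, rfl⟩ := hL
  obtain ⟨l', hl', rfl⟩ := hL'
  exact (key l l' hl hl' hA hB hA' hB').antisymm (key l' l hl' hl hA' hB' hA hB)

/-- The line through two distinct points. -/
def join (A B : Plane) : Set Plane :=
  {Z | (B 1 - A 1) * Z 0 + (A 0 - B 0) * Z 1 + (B 0 * A 1 - A 0 * B 1) = 0}

theorem isLine_join {A B : Plane} (h : A ≠ B) : IsLine (join A B) := by
  refine ⟨_, totalDegree_linear (a := B 1 - A 1) (b := A 0 - B 0) (B 0 * A 1 - A 0 * B 1) ?_, ?_⟩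
  · by_contra! h'
    apply h
    ext i
    fin_cases i
    · exact sub_eq_zero.1 h'.2
    · exact (sub_eq_zero.1 h'.1).symm
  · ext Z
    simp only [join, zeros, Set.mem_ofPred_eq, eval_linear]

theorem left_mem_join (A B : Plane) : A ∈ join A B := by
  simp only [join, Set.mem_ofPred_eq]; ring

theorem right_mem_join (A B : Plane) : B ∈ join A B := by
  simp only [join, Set.mem_ofPred_eq]; ring

theorem join_comm (A B : Plane) : join A B = join B A := by
  ext Z
  simp only [join, Set.mem_ofPred_eq]
  constructor <;> intro h <;> linarith

theorem IsLine.eq_join {L : Set Plane} (hL : IsLine L) {A B : Plane} (hAB : A ≠ B) (hA : A ∈ L)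
    (hB : B ∈ L) : L = join A B :=
  hL.eq_of_mem (isLine_join hAB) hAB hA hB (left_mem_join A B) (right_mem_join A B)

/-! ### Poised sets, GC sets and removal of a maximal line -/

/-- The nodes of `X` lying on `L`. -/
noncomputable def nodesOn (X : Finset Plane) (L : Set Plane) : Finset Plane :=
  X.filter (· ∈ L)

/-- The nodes of `X` lying outside `L`. -/
noncomputable def nodesOff (X : Finset Plane) (L : Set Plane) : Finset Plane :=
  X.filter (· ∉ L)

@[simp] theorem mem_nodesOn {X : Finset Plane} {L : Set Plane} {A : Plane} :
    A ∈ nodesOn X L ↔ A ∈ X ∧ A ∈ L := by simp [nodesOn]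

@[simp] theorem mem_nodesOff {X : Finset Plane} {L : Set Plane} {A : Plane} :
    A ∈ nodesOff X L ↔ A ∈ X ∧ A ∉ L := by simp [nodesOff]

theorem card_nodesOn_add_card_nodesOff (X : Finset Plane) (L : Set Plane) :
    (nodesOn X L).card + (nodesOff X L).card = X.card := by
  simpa [nodesOn, nodesOff] using X.card_filter_add_card_filter_not (· ∈ L)

theorem nodesOff_comm (X : Finset Plane) (L L' : Set Plane) :
    nodesOff (nodesOff X L) L' = nodesOff (nodesOff X L') L := by
  ext A; simp; tauto

theorem isNodeLine_iff {k : ℕ} {X : Finset Plane} {L : Set Plane} :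
    IsNodeLine k X L ↔ IsLine L ∧ (nodesOn X L).card = k := by
  have : ((X : Set Plane) ∩ L) = (nodesOn X L : Set Plane) := by
    ext A; simp
  rw [IsNodeLine, this, Set.ncard_coe_finset]

theorem isMaximalLine_iff {n : ℕ} {X : Finset Plane} {L : Set Plane} :
    IsMaximalLine n X L ↔ IsLine L ∧ (nodesOn X L).card = n + 1 := isNodeLine_iff

theorem IsPoised.eq_zero {n : ℕ} {X : Finset Plane} (hX : IsPoised n X) {p : BiPoly}
    (hp : p.totalDegree ≤ n) (h : ∀ A ∈ X, eval A p = 0) : p = 0 :=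
  (hX 0).unique ⟨hp, h⟩ ⟨by simp, by simp⟩

theorem IsPoised.exists_eval_eq {n : ℕ} {X : Finset Plane} (hX : IsPoised n X) (c : Plane → ℝ) :
    ∃ p : BiPoly, p.totalDegree ≤ n ∧ ∀ A ∈ X, eval A p = c A :=
  (hX c).exists

theorem IsPoised.exists_isFundamental {n : ℕ} {X : Finset Plane} (hX : IsPoised n X) {A : Plane}
    (hA : A ∈ X) : ∃ p, IsFundamental n X A p := by
  obtain ⟨p, hp, h⟩ := hX.exists_eval_eq (fun B => if B = A then 1 else 0)
  refine ⟨p, hp, by simp [h A hA], fun B hB hBA => by simp [h B hB, hBA]⟩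

theorem IsFundamental.ne_zero {n : ℕ} {X : Finset Plane} {A : Plane} {p : BiPoly}
    (h : IsFundamental n X A p) : p ≠ 0 := by
  rintro rfl
  simpa using h.2.1

theorem IsPoised.card_nodesOn_le {n : ℕ} {X : Finset Plane} (hX : IsPoised n X) {L : Set Plane}
    (hL : IsLine L) : (nodesOn X L).card ≤ n + 1 := by
  by_contra! h
  obtain ⟨A, hA⟩ : (nodesOn X L).Nonempty := Finset.card_pos.1 (by omega)
  obtain ⟨p, hp⟩ := hX.exists_isFundamental (mem_nodesOn.1 hA).1
  obtain ⟨l, hl, rfl⟩ := hL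
  have hd : l ∣ p := by
    apply dvd_of_zeros hl (S := (nodesOn X (zeros l)).erase A)
    · intro B hB
      obtain ⟨hBA, hB⟩ := Finset.mem_erase.1 hB
      exact ⟨(mem_nodesOn.1 hB).2, hp.2.2 B (mem_nodesOn.1 hB).1 hBA⟩
    · rw [Finset.card_erase_of_mem hA]
      have := hp.1
      omega
  have := eval_eq_zero_of_dvd hd (mem_nodesOn.1 hA).2
  rw [hp.2.1] at this
  exact one_ne_zero this

theorem eval_ne_zero_of_notMem {l : BiPoly} {A : Plane} (h : A ∉ zeros l) : eval A l ≠ 0 := h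

/-- Multiplication by the equation `m` of `M` carries interpolation off `M` to interpolation on `X`
of data vanishing on `M`; the solutions there are divisible by `m`. -/
theorem IsPoised.remove {n : ℕ} {X : Finset Plane} (hX : IsPoised (n + 1) X) {M : Set Plane}
    (hM : IsMaximalLine (n + 1) X M) : IsPoised n (nodesOff X M) := by
  obtain ⟨⟨m, hm, rfl⟩, hcard⟩ := isMaximalLine_iff.1 hM
  intro c
  obtain ⟨p, hp, hpc⟩ := hX.exists_eval_eq (fun A => c A * eval A m)
  have hd : m ∣ p := by
    apply dvd_of_zeros hm (S := nodesOn X (zeros m))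
    · intro A hA
      obtain ⟨hA, hAm⟩ := mem_nodesOn.1 hA
      refine ⟨hAm, ?_⟩
      have : eval A m = 0 := hAm
      rw [hpc A hA, this, mul_zero]
    · omega
  obtain ⟨q, hq⟩ := hd
  refine ⟨q, ⟨?_, ?_⟩, ?_⟩
  · by_cases h0 : p = 0
    · have : q = 0 := by
        rw [h0] at hq
        rcases mul_eq_zero.1 hq.symm with h | h
        · exact absurd h (ne_zero_of_totalDegree_eq_one hm)
        · exact h
      simp [this]
    · have := totalDegree_of_eq_mul hm h0 hq
      omega
  · intro A hA
    obtain ⟨hA, hAm⟩ := mem_nodesOff.1 hA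
    have := hpc A hA
    rw [hq, map_mul, mul_comm] at this
    exact mul_right_cancel₀ (eval_ne_zero_of_notMem hAm) this
  · rintro q' ⟨hq', hq'c⟩
    have : m * q' = p := by
      refine (hX fun A => c A * eval A m).unique ⟨?_, ?_⟩ ⟨hp, hpc⟩
      · refine (totalDegree_mul _ _).trans ?_
        omega
      · intro A hA
        rw [map_mul]
        by_cases hAm : A ∈ zeros m
        · have : eval A m = 0 := hAm
          simp [this]
        · rw [hq'c A (mem_nodesOff.2 ⟨hA, hAm⟩), mul_comm]
    rw [hq] at this
    exact mul_left_cancel₀ (ne_zero_of_totalDegree_eq_one hm) this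

/-- Up to a scalar, `m` times the fundamental polynomial off `M` is the one for `X`. As `m` is prime
it divides one of the linear factors and cancels against it. -/
theorem IsGC.remove {n : ℕ} {X : Finset Plane} (hX : IsGC (n + 1) X) {M : Set Plane}
    (hM : IsMaximalLine (n + 1) X M) : IsGC n (nodesOff X M) := by
  refine ⟨hX.1.remove hM, ?_⟩
  obtain ⟨⟨m, hm, rfl⟩, hcard⟩ := isMaximalLine_iff.1 hM
  intro A hA q hq
  obtain ⟨hA, hAm⟩ := mem_nodesOff.1 hA
  have hAm' := eval_ne_zero_of_notMem hAm
  obtain ⟨f, hf, hprod⟩ := hX.2 A hA (C (eval A m)⁻¹ * (m * q)) (by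
    refine ⟨?_, ?_, ?_⟩
    · refine (totalDegree_mul _ _).trans ?_
      have h1 := totalDegree_mul m q
      have h2 := hq.1
      rw [totalDegree_C]
      omega
    · simp [hq.2.1, hAm']
    · intro B hB hBA
      by_cases hBm : B ∈ zeros m
      · have : eval B m = 0 := hBm
        simp [this]
      · simp [hq.2.2 B (mem_nodesOff.2 ⟨hB, hBm⟩) hBA])
  obtain ⟨i, -, hi⟩ := (prime_of_totalDegree_eq_one hm).exists_mem_finset_dvd
    (s := Finset.univ) (f := f) (by rw [← hprod]; exact ⟨C (eval A m)⁻¹ * q, by ring⟩)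
  obtain ⟨r, hr⟩ := hi
  have hfi0 := ne_zero_of_totalDegree_eq_one (hf i)
  have hr0 : r.totalDegree = 0 := by
    have := totalDegree_of_eq_mul hm hfi0 hr
    have := hf i
    omega
  rw [totalDegree_eq_zero_iff_eq_C] at hr0
  set d := r.coeff 0
  rw [Fin.prod_univ_succAbove f i, hr, hr0] at hprod
  have hq' : q = C (eval A m * d) * ∏ j, f (i.succAbove j) := by
    apply mul_left_cancel₀ (ne_zero_of_totalDegree_eq_one hm)
    have h1 : (C (eval A m) * C (eval A m)⁻¹ : BiPoly) = 1 := by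
      rw [← C_mul, mul_inv_cancel₀ hAm', C_1]
    rw [C_mul]
    linear_combination C (eval A m) * hprod - m * q * h1
  have hd0 : eval A m * d ≠ 0 := by
    intro h
    rw [h] at hq'
    apply hq.ne_zero
    simpa using hq'
  -- The leftover scalar is absorbed into one linear factor. In degree 0 there is none, but there
  -- the scalar is 1 because `q` takes the value 1 at `A`.
  cases n with
  | zero =>
    refine ⟨Fin.elim0, fun i => i.elim0, ?_⟩
    have := hq.2.1
    rw [hq'] at this
    simp at this
    rw [hq']
    simp [this]
  | succ n =>
    refine ⟨Fin.cons (C (eval A m * d) * f (i.succAbove 0)) fun j => f (i.succAbove j.succ),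
      ?_, ?_⟩
    · intro j
      refine Fin.cases ?_ (fun j => ?_) j
      · rw [Fin.cons_zero, totalDegree_mul_of_isDomain (by simpa using hd0)
          (ne_zero_of_totalDegree_eq_one (hf _)), totalDegree_C, hf]
      · rw [Fin.cons_succ]; exact hf _
    · rw [hq', Fin.prod_univ_succ, Fin.prod_univ_succ]
      simp [mul_assoc]

theorem nodesOn_nodesOff_of_disjoint {X : Finset Plane} {L M : Set Plane}
    (h : ∀ A ∈ X, A ∈ L → A ∉ M) : nodesOn (nodesOff X M) L = nodesOn X L := by
  ext A
  have := h A
  simp only [mem_nodesOn, mem_nodesOff]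
  tauto

theorem nodesOn_nodesOff_eq_erase {X : Finset Plane} {L M : Set Plane} (hL : IsLine L)
    (hM : IsLine M) (hne : L ≠ M) {A : Plane} (hAL : A ∈ L) (hAM : A ∈ M) :
    nodesOn (nodesOff X M) L = (nodesOn X L).erase A := by
  ext B
  simp only [mem_nodesOn, mem_nodesOff, Finset.mem_erase]
  constructor
  · rintro ⟨⟨hB, hBM⟩, hBL⟩
    exact ⟨fun h => hBM (h ▸ hAM), hB, hBL⟩
  · rintro ⟨hBA, hB, hBL⟩
    exact ⟨⟨hB, fun hBM => hne (hL.eq_of_mem hM hBA hBL hAL hBM hAM)⟩, hBL⟩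

theorem card_nodesOn_nodesOff_of_mem {X : Finset Plane} {L M : Set Plane} (hL : IsLine L)
    (hM : IsLine M) (hne : L ≠ M) {A : Plane} (hA : A ∈ X) (hAL : A ∈ L) (hAM : A ∈ M) :
    (nodesOn (nodesOff X M) L).card + 1 = (nodesOn X L).card := by
  rw [nodesOn_nodesOff_eq_erase hL hM hne hAL hAM]
  exact Finset.card_erase_add_one (mem_nodesOn.2 ⟨hA, hAL⟩)

/-- Two distinct maximal lines meet at a node. -/
theorem IsPoised.exists_mem_inter {n : ℕ} {X : Finset Plane} (hX : IsPoised n X)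
    {M M' : Set Plane} (hM : IsMaximalLine n X M) (hM' : IsMaximalLine n X M') :
    ∃ A ∈ X, A ∈ M ∧ A ∈ M' := by
  by_contra! hno
  have hM1 := isMaximalLine_iff.1 hM
  have hM1' := isMaximalLine_iff.1 hM'
  cases n with
  | zero =>
    obtain ⟨A, hA⟩ : (nodesOn X M).Nonempty := Finset.card_pos.1 (by omega)
    obtain ⟨B, hB⟩ : (nodesOn X M').Nonempty := Finset.card_pos.1 (by omega)
    rw [mem_nodesOn] at hA hB
    have hAB : A ≠ B := fun h => hno A hA.1 hA.2 (h ▸ hB.2)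
    obtain ⟨p, hp⟩ := hX.exists_isFundamental hA.1
    have h0 : p.totalDegree = 0 := by have := hp.1; omega
    rw [totalDegree_eq_zero_iff_eq_C] at h0
    have h1 := hp.2.1
    have h2 := hp.2.2 B hB.1 hAB.symm
    rw [h0] at h1 h2
    simp at h1 h2
    rw [h1] at h2
    exact one_ne_zero h2
  | succ n =>
    -- Without a shared node all `n + 2` nodes of `M'` would survive in a set that is only
    -- `n`-poised.
    have h1 := (hX.remove hM).card_nodesOn_le hM1'.1
    rw [nodesOn_nodesOff_of_disjoint fun A hA h h' => hno A hA h' h] at h1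
    omega

/-- A maximal line remains maximal after another maximal line has been removed. -/
theorem IsPoised.isMaximalLine_nodesOff {n : ℕ} {X : Finset Plane} (hX : IsPoised (n + 1) X)
    {M M' : Set Plane} (hM : IsMaximalLine (n + 1) X M) (hM' : IsMaximalLine (n + 1) X M')
    (hne : M ≠ M') : IsMaximalLine n (nodesOff X M) M' := by
  obtain ⟨A, hA, hAM, hAM'⟩ := hX.exists_mem_inter hM hM'
  rw [isMaximalLine_iff] at *
  refine ⟨hM'.1, ?_⟩
  have := card_nodesOn_nodesOff_of_mem hM'.1 hM.1 hne.symm hA hAM' hAM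
  omega

/-- Three distinct maximal lines are not concurrent. -/
theorem IsPoised.not_concurrent {n : ℕ} {X : Finset Plane} (hX : IsPoised (n + 1) X)
    {M₁ M₂ M₃ : Set Plane} (h₁ : IsMaximalLine (n + 1) X M₁) (h₂ : IsMaximalLine (n + 1) X M₂)
    (h₃ : IsMaximalLine (n + 1) X M₃) (h₁₂ : M₁ ≠ M₂) (h₁₃ : M₁ ≠ M₃) (h₂₃ : M₂ ≠ M₃) {A : Plane}
    (hA₁ : A ∈ M₁) (hA₂ : A ∈ M₂) (hA₃ : A ∈ M₃) : False := by
  obtain ⟨B, hB, hB₂, hB₃⟩ := (hX.remove h₁).exists_mem_inter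
    (hX.isMaximalLine_nodesOff h₁ h₂ h₁₂) (hX.isMaximalLine_nodesOff h₁ h₃ h₁₃)
  have hAB : A ≠ B := fun h => (mem_nodesOff.1 hB).2 (h ▸ hA₁)
  exact h₂₃ (h₂.1.eq_of_mem h₃.1 hAB hA₂ hB₂ hA₃ hB₃)

theorem IsPoised.card_eq_one {X : Finset Plane} (hX : IsPoised 0 X) : X.card = 1 := by
  rw [Finset.card_eq_one]
  have hne : X.Nonempty := by
    by_contra h
    rw [Finset.not_nonempty_iff_eq_empty] at h
    have := hX.eq_zero (p := 1) (by simp) (by simp [h])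
    exact one_ne_zero this
  obtain ⟨A, hA⟩ := hne
  refine ⟨A, Finset.eq_singleton_iff_unique_mem.2 ⟨hA, fun B hB => ?_⟩⟩
  by_contra hBA
  obtain ⟨p, hp⟩ := hX.exists_isFundamental hA
  have h0 : p.totalDegree = 0 := by have := hp.1; omega
  rw [totalDegree_eq_zero_iff_eq_C] at h0
  have h1 := hp.2.1
  have h2 := hp.2.2 B hB hBA
  rw [h0, eval_C] at h1 h2
  rw [h1] at h2
  exact one_ne_zero h2

/-- Peeling off maximal lines replaces the computation of the dimension of the polynomial space. -/
theorem IsGC.card_eq {n : ℕ} (hGM : ∀ k : ℕ, 1 ≤ k → k ≤ n → GascaMaeztu k) {X : Finset Plane}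
    (hX : IsGC n X) : X.card = (n + 2).choose 2 := by
  induction n generalizing X with
  | zero => rw [hX.1.card_eq_one]; rfl
  | succ n ih =>
    obtain ⟨M, hM⟩ := hGM (n + 1) (by omega) le_rfl X hX
    have h1 := ih (fun k h1 h2 => hGM k h1 (by omega)) (hX.remove hM)
    have h2 := (isMaximalLine_iff.1 hM).2
    have h3 := card_nodesOn_add_card_nodesOff X M
    have h4 : (n + 1 + 2).choose 2 = (n + 2).choose 1 + (n + 2).choose 2 :=
      Nat.choose_succ_succ _ _
    rw [Nat.choose_one_right] at h4
    omega

/-! ### The users of a line in the two configurations -/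

theorem mem_users {n : ℕ} {X : Finset Plane} {L : Set Plane} {A : Plane} :
    A ∈ users n X L ↔ A ∈ X ∧ Uses n X A L := by simp [users]

theorem Uses.notMem {n : ℕ} {X : Finset Plane} {A : Plane} {L : Set Plane} (h : Uses n X A L) :
    A ∉ L := by
  obtain ⟨p, l, q, hp, -, rfl, -, rfl⟩ := h
  intro hA
  have h1 := hp.2.1
  have h2 : eval A l = 0 := hA
  rw [map_mul, h2, zero_mul] at h1
  exact zero_ne_one h1

/-- Factor a line out of a polynomial with enough zeros on the line. -/
theorem exists_eq_mul {L : Set Plane} (hL : IsLine L) {p : BiPoly} (hp : p ≠ 0) {S : Finset Plane}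
    (hS : ∀ A ∈ S, A ∈ L ∧ eval A p = 0) (hcard : p.totalDegree < S.card) :
    ∃ l q : BiPoly, l.totalDegree = 1 ∧ L = zeros l ∧ p = l * q ∧ q ≠ 0 ∧
      p.totalDegree = q.totalDegree + 1 := by
  obtain ⟨l, hl, rfl⟩ := hL
  obtain ⟨q, hq⟩ := dvd_of_zeros hl hS hcard
  exact ⟨l, q, hl, rfl, hq, fun h => hp (by simp [hq, h]), totalDegree_of_eq_mul hl hp hq⟩

theorem eval_right_eq_zero {l q : BiPoly} {B : Plane} (hB : B ∉ zeros l)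
    (h : eval B (l * q) = 0) : eval B q = 0 := by
  rw [map_mul] at h
  exact (mul_eq_zero.1 h).resolve_left hB

/-- For a node off both lines, `M` splits off first (`n + 1` zeros), then `L` (`n` zeros, degree `n
- 1`). For a user on `M`, the cofactor of `L` would vanish at the other `n` nodes of `M`, hence at
the user as well. -/
theorem users_eq_of_disjoint {n : ℕ} {X : Finset Plane} (hX : IsPoised n X)
    {L M : Set Plane} (hL : IsNodeLine n X L) (hM : IsMaximalLine n X M)
    (hdisj : ∀ A ∈ X, A ∈ M → A ∉ L) : users n X L = nodesOff (nodesOff X M) L := by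
  rw [isNodeLine_iff] at hL
  rw [isMaximalLine_iff] at hM
  ext A
  simp only [mem_users, mem_nodesOff]
  constructor
  · rintro ⟨hA, hu⟩
    refine ⟨⟨hA, fun hAM => ?_⟩, hu.notMem⟩
    obtain ⟨p, l, q, hp, hl, rfl, hq, rfl⟩ := hu
    obtain ⟨m, hm, rfl⟩ := hM.1
    have hd : m ∣ q := by
      apply dvd_of_zeros hm (S := (nodesOn X (zeros m)).erase A)
      · intro B hB
        rw [Finset.mem_erase, mem_nodesOn] at hB
        exact ⟨hB.2.2, eval_right_eq_zero (hdisj B hB.2.1 hB.2.2) (hp.2.2 B hB.2.1 hB.1)⟩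
      · rw [Finset.card_erase_of_mem (mem_nodesOn.2 ⟨hA, hAM⟩)]
        omega
    have := hp.2.1
    rw [map_mul, eval_eq_zero_of_dvd hd hAM, mul_zero] at this
    exact zero_ne_one this
  · rintro ⟨⟨hA, hAM⟩, hAL⟩
    refine ⟨hA, ?_⟩
    obtain ⟨p, hp⟩ := hX.exists_isFundamental hA
    have hdeg := hp.1
    obtain ⟨m, q, hm, rfl, hpq, hq0, hpd⟩ := exists_eq_mul hM.1 hp.ne_zero
      (S := nodesOn X M) (fun B hB => by
        rw [mem_nodesOn] at hB
        exact ⟨hB.2, hp.2.2 B hB.1 fun h => hAM (h ▸ hB.2)⟩) (by omega)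
    obtain ⟨l, r, hl, rfl, hqr, hr0, hqd⟩ := exists_eq_mul hL.1 hq0
      (S := nodesOn X L) (fun B hB => by
        rw [mem_nodesOn] at hB
        refine ⟨hB.2, eval_right_eq_zero (l := m) (fun h => hdisj B hB.1 h hB.2) ?_⟩
        rw [← hpq]
        exact hp.2.2 B hB.1 fun h => hAL (h ▸ hB.2)) (by omega)
    refine ⟨p, l, m * r, hp, hl, rfl, ?_, by rw [hpq, hqr]; ring⟩
    have := totalDegree_mul m r
    omega

/-- The lines split off one after another. Only `P` is lost as a zero, and only once on each later
line, so the zeros keep exceeding the degree: `n + 1`, `n`, `n - 1` against degrees at most `n`, `n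
- 1`, `n - 2`. -/
theorem users_eq_of_concurrent {n : ℕ} {X : Finset Plane} (hX : IsPoised n X)
    {L M M' : Set Plane} (hL : IsNodeLine n X L) (hM : IsMaximalLine n X M)
    (hM' : IsMaximalLine n X M') (hne : M ≠ M') {P : Plane} (hP : P ∈ X) (hPL : P ∈ L)
    (hPM : P ∈ M) (hPM' : P ∈ M') :
    users n X L = nodesOff (nodesOff (nodesOff X M) M') L := by
  rw [isNodeLine_iff] at hL
  rw [isMaximalLine_iff] at hM hM'
  have hLM : L ≠ M := by rintro rfl; omega
  have hLM' : L ≠ M' := by rintro rfl; omega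
  ext A
  simp only [mem_users, mem_nodesOff]
  constructor
  · rintro ⟨hA, hu⟩
    have hAP : A ≠ P := fun h => hu.notMem (h ▸ hPL)
    suffices key : ∀ N N' : Set Plane, IsLine N ∧ (nodesOn X N).card = n + 1 →
        IsLine N' ∧ (nodesOn X N').card = n + 1 → N ≠ N' → L ≠ N → L ≠ N' → P ∈ N → P ∈ N' →
        A ∉ N by
      exact ⟨⟨⟨hA, key M M' hM hM' hne hLM hLM' hPM hPM'⟩,
        key M' M hM' hM hne.symm hLM' hLM hPM' hPM⟩, hu.notMem⟩
    intro N N' hN hN' hne hLN hLN' hPN hPN' hAN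
    obtain ⟨p, l, q, hp, hl, rfl, hq, rfl⟩ := hu
    have hq0 : q ≠ 0 := fun h => hp.ne_zero (by simp [h])
    have hLl : IsLine (zeros l) := hL.1
    have hAN' : A ∉ N' := fun h => hne (hN.1.eq_of_mem hN'.1 hAP hAN hPN h hPN')
    obtain ⟨m, r, hm, rfl, hqr, hr0, hqd⟩ := exists_eq_mul hN'.1 hq0
      (S := (nodesOn X N').erase P) (fun B hB => by
        rw [Finset.mem_erase, mem_nodesOn] at hB
        refine ⟨hB.2.2, eval_right_eq_zero (l := l) (fun h => hLN'
          (hLl.eq_of_mem hN'.1 hB.1 h hPL hB.2.2 hPN')) (hp.2.2 B hB.2.1 ?_)⟩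
        exact fun h => hAN' (h ▸ hB.2.2)) (by
        rw [Finset.card_erase_of_mem (mem_nodesOn.2 ⟨hP, hPN'⟩)]
        omega)
    obtain ⟨m', hm', rfl⟩ := hN.1
    have hd : m' ∣ r := by
      apply dvd_of_zeros hm' (S := ((nodesOn X (zeros m')).erase P).erase A)
      · intro B hB
        rw [Finset.mem_erase, Finset.mem_erase, mem_nodesOn] at hB
        obtain ⟨hBA, hBP, hB, hBN⟩ := hB
        refine ⟨hBN, eval_right_eq_zero (l := m) (fun h => hne
          (hN.1.eq_of_mem hN'.1 hBP hBN hPN h hPN')) ?_⟩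
        rw [← hqr]
        exact eval_right_eq_zero (l := l) (fun h => hLN
          (hLl.eq_of_mem hN.1 hBP h hPL hBN hPN)) (hp.2.2 B hB hBA)
      · rw [Finset.card_erase_of_mem (Finset.mem_erase.2 ⟨hAP, mem_nodesOn.2 ⟨hA, hAN⟩⟩),
          Finset.card_erase_of_mem (mem_nodesOn.2 ⟨hP, hPN⟩)]
        omega
    have := hp.2.1
    rw [hqr, map_mul, map_mul, eval_eq_zero_of_dvd hd hAN, mul_zero, mul_zero] at this
    exact zero_ne_one this
  · rintro ⟨⟨⟨hA, hAM⟩, hAM'⟩, hAL⟩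
    refine ⟨hA, ?_⟩
    obtain ⟨p, hp⟩ := hX.exists_isFundamental hA
    have hdeg := hp.1
    obtain ⟨m, q, hm, rfl, hpq, hq0, hpd⟩ := exists_eq_mul hM.1 hp.ne_zero
      (S := nodesOn X M) (fun B hB => by
        rw [mem_nodesOn] at hB
        exact ⟨hB.2, hp.2.2 B hB.1 fun h => hAM (h ▸ hB.2)⟩) (by omega)
    obtain ⟨m', r, hm', rfl, hqr, hr0, hqd⟩ := exists_eq_mul hM'.1 hq0
      (S := (nodesOn X M').erase P) (fun B hB => by
        rw [Finset.mem_erase, mem_nodesOn] at hB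
        refine ⟨hB.2.2, eval_right_eq_zero (l := m) (fun h => hne
          (hM.1.eq_of_mem hM'.1 hB.1 h hPM hB.2.2 hPM')) ?_⟩
        rw [← hpq]
        exact hp.2.2 B hB.2.1 fun h => hAM' (h ▸ hB.2.2)) (by
        rw [Finset.card_erase_of_mem (mem_nodesOn.2 ⟨hP, hPM'⟩)]
        omega)
    obtain ⟨l, s, hl, rfl, hrs, hs0, hrd⟩ := exists_eq_mul hL.1 hr0
      (S := (nodesOn X L).erase P) (fun B hB => by
        rw [Finset.mem_erase, mem_nodesOn] at hB
        refine ⟨hB.2.2, eval_right_eq_zero (l := m') (fun h => hLM'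
          (hL.1.eq_of_mem hM'.1 hB.1 hB.2.2 hPL h hPM')) ?_⟩
        rw [← hqr]
        refine eval_right_eq_zero (l := m) (fun h => hLM
          (hL.1.eq_of_mem hM.1 hB.1 hB.2.2 hPL h hPM)) ?_
        rw [← hpq]
        exact hp.2.2 B hB.2.1 fun h => hAL (h ▸ hB.2.2)) (by
        rw [Finset.card_erase_of_mem (mem_nodesOn.2 ⟨hP, hPL⟩)]
        omega)
    refine ⟨p, l, m * m' * s, hp, hl, rfl, ?_, by rw [hpq, hqr, hrs]; ring⟩
    have := totalDegree_mul (m * m') s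
    have := totalDegree_mul m m'
    omega

/-! ### Taylor coefficients at a node and uniqueness of the new maximal line -/

/-- The zeros determine `u` up to a scalar, so the ratio of its coefficients depends on `R` alone.
The root 0 is simple, hence the linear coefficient is nonzero. -/
theorem exists_coeff_two_eq_mul {R : Finset ℝ} (h0 : (0 : ℝ) ∈ R) :
    ∃ S : ℝ, ∀ u : Polynomial ℝ, u ≠ 0 → u.natDegree ≤ R.card → (∀ t ∈ R, u.eval t = 0) →
      u.coeff 2 = S * u.coeff 1 ∧ u.coeff 1 ≠ 0 := by
  set w : Polynomial ℝ := ∏ t ∈ R.erase 0, (Polynomial.X - Polynomial.C t) with hw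
  have hw0 : w.coeff 0 ≠ 0 := by
    rw [Polynomial.coeff_zero_eq_eval_zero, hw, Polynomial.eval_prod]
    refine Finset.prod_ne_zero_iff.2 fun t ht => ?_
    simpa using (Finset.mem_erase.1 ht).1
  have hR : ∏ t ∈ R, (Polynomial.X - Polynomial.C t) = Polynomial.X * w := by
    rw [← Finset.mul_prod_erase R _ h0]
    simp [hw]
  refine ⟨w.coeff 1 / w.coeff 0, fun u hu hdeg hz => ?_⟩
  have hd : Polynomial.X * w ∣ u := by
    rw [← hR]
    have := (Multiset.prod_X_sub_C_dvd_iff_le_roots hu R.val).2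
      ((Multiset.le_iff_subset R.nodup).2 fun t ht => (Polynomial.mem_roots hu).2 (hz t ht))
    exact this
  obtain ⟨q, hq⟩ := hd
  have hwm : (Polynomial.X * w).natDegree = R.card := by
    rw [← hR, Polynomial.natDegree_prod_of_monic _ _ fun t _ => Polynomial.monic_X_sub_C t]
    simp
  have hw1 : Polynomial.X * w ≠ 0 := fun h => hu (by simp [hq, h])
  have hq0 : q ≠ 0 := fun h => hu (by simp [hq, h])
  have hqd : q.natDegree = 0 := by
    rw [hq, Polynomial.natDegree_mul hw1 hq0] at hdeg
    omega
  rw [Polynomial.natDegree_eq_zero] at hqd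
  obtain ⟨c, rfl⟩ := hqd
  have hc : c ≠ 0 := by rintro rfl; simp at hq0
  rw [hq, mul_comm, Polynomial.coeff_C_mul, Polynomial.coeff_C_mul, Polynomial.coeff_X_mul,
    Polynomial.coeff_X_mul]
  exact ⟨by field_simp, mul_ne_zero hc hw0⟩

theorem lineHom_of_eval_eq_zero {f : BiPoly} (hf : f.totalDegree = 1) {B : Plane}
    (hB : eval B f = 0) (v : Plane) :
    lineHom B v f = Polynomial.C (eval (B + v) f) * Polynomial.X := by
  obtain ⟨a, b, c, -, rfl⟩ := exists_coeffs_of_totalDegree_eq_one hf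
  rw [eval_linear] at hB
  have hc : c = -(a * B 0) - b * B 1 := by linarith
  rw [eval_linear, hc]
  simp only [lineHom, map_add, map_mul, aeval_X, aeval_C, Polynomial.algebraMap_eq, Pi.add_apply,
    map_sub, map_neg]
  ring

theorem eval_add_of_eval_eq_zero {f : BiPoly} (hf : f.totalDegree = 1) {B : Plane}
    (hB : eval B f = 0) (v w : Plane) :
    eval (B + (v + w)) f = eval (B + v) f + eval (B + w) f := by
  obtain ⟨a, b, c, -, rfl⟩ := exists_coeffs_of_totalDegree_eq_one hf
  rw [eval_linear] at hB
  simp only [eval_linear, Pi.add_apply]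
  linarith

theorem coeff_zero_lineHom (B v : Plane) (g : BiPoly) : (lineHom B v g).coeff 0 = eval B g := by
  rw [Polynomial.coeff_zero_eq_eval_zero, eval_lineHom]
  simp

/-- The linear coefficient is the directional derivative at `B`, which is additive in the direction.
-/
theorem coeff_one_lineHom_add (B v w : Plane) (g : BiPoly) :
    (lineHom B (v + w) g).coeff 1 = (lineHom B v g).coeff 1 + (lineHom B w g).coeff 1 := by
  induction g using MvPolynomial.induction_on with
  | C a => simp [lineHom]
  | add p q hp hq => simp only [map_add, Polynomial.coeff_add, hp, hq]; ring
  | mul_X p i hp =>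
    simp only [map_mul, Polynomial.mul_coeff_one, hp, coeff_zero_lineHom]
    simp [lineHom]
    ring

/-- Since `f` vanishes at `B`, the first coefficient of `p` along `u` is `f (B + u) * g B` and the
second is `f (B + u)` times the derivative of `g` along `u`. So the derivatives of `g` along `v` and
`w` are `S * g B` and `T * g B`, and they add up. The conclusion is linear in `p` and no longer
mentions the factorization. -/
theorem coeff_two_lineHom_add {p f g : BiPoly} (hp : p = f * g) (hf : f.totalDegree = 1)
    {B v w : Plane} (hB : eval B f = 0) {S T : ℝ}
    (hv : (lineHom B v p).coeff 2 = S * (lineHom B v p).coeff 1)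
    (hv' : (lineHom B v p).coeff 1 ≠ 0)
    (hw : (lineHom B w p).coeff 2 = T * (lineHom B w p).coeff 1)
    (hw' : (lineHom B w p).coeff 1 ≠ 0) :
    (lineHom B (v + w) p).coeff 2 =
      (S + T) * ((lineHom B v p).coeff 1 + (lineHom B w p).coeff 1) := by
  have h (u : Plane) : lineHom B u p =
      Polynomial.C (eval (B + u) f) * (Polynomial.X * lineHom B u g) := by
    rw [hp, map_mul, lineHom_of_eval_eq_zero hf hB, mul_assoc]
  have h1 (u : Plane) : (lineHom B u p).coeff 1 = eval (B + u) f * eval B g := by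
    rw [h, Polynomial.coeff_C_mul, Polynomial.coeff_X_mul, coeff_zero_lineHom]
  have h2 (u : Plane) : (lineHom B u p).coeff 2 = eval (B + u) f * (lineHom B u g).coeff 1 := by
    rw [h, Polynomial.coeff_C_mul, Polynomial.coeff_X_mul]
  rw [h1] at hv' hw'
  have ev : (lineHom B v g).coeff 1 = S * eval B g := by
    apply mul_left_cancel₀ (left_ne_zero_of_mul hv')
    rw [← h2, hv, h1]; ring
  have ew : (lineHom B w g).coeff 1 = T * eval B g := by
    apply mul_left_cancel₀ (left_ne_zero_of_mul hw')
    rw [← h2, hw, h1]; ring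
  rw [h2, h1, h1, coeff_one_lineHom_add, ev, ew, eval_add_of_eval_eq_zero hf hB]
  ring

/-- A polynomial vanishing outside `M` is a combination of fundamental polynomials of the
nodes on `M`, so a linear functional that kills the latter kills the former. -/
theorem linearMap_eq_zero {n : ℕ} {X : Finset Plane} (hX : IsPoised n X) {M : Set Plane}
    (F : BiPoly →ₗ[ℝ] ℝ)
    (hF : ∀ A ∈ X, A ∈ M → ∀ p, IsFundamental n X A p → F p = 0) {p : BiPoly}
    (hp : p.totalDegree ≤ n) (hz : ∀ A ∈ nodesOff X M, eval A p = 0) : F p = 0 := by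
  choose! f hf using fun A (hA : A ∈ X) => hX.exists_isFundamental hA
  have hsum : p - ∑ A ∈ X, eval A p • f A = 0 := by
    apply hX.eq_zero
    · refine (totalDegree_sub _ _).trans (max_le hp (totalDegree_finsetSum_le fun A hA => ?_))
      exact (totalDegree_smul_le _ _).trans (hf A hA).1
    · intro B hB
      rw [map_sub, map_sum, Finset.sum_eq_single B]
      · simp [smul_eval, (hf B hB).2.1]
      · intro A hA hAB
        simp [smul_eval, (hf A hA).2.2 B hB hAB.symm]
      · exact fun h => absurd hB h
  rw [sub_eq_zero.1 hsum, map_sum]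
  refine Finset.sum_eq_zero fun A hA => ?_
  rw [map_smul]
  by_cases hAM : A ∈ M
  · rw [hF A hA hAM _ (hf A hA), smul_zero]
  · rw [hz A (mem_nodesOff.2 ⟨hA, hAM⟩), zero_smul]

/-- The fundamental polynomial of a node on the maximal line `M` is not divisible by a line
that has no node on `M`. -/
theorem IsFundamental.not_dvd {n : ℕ} {X : Finset Plane} {M : Set Plane}
    (hM : IsMaximalLine n X M) {l : BiPoly} (hl : l.totalDegree = 1)
    (hlM : ∀ A ∈ X, A ∈ M → A ∉ zeros l) {A : Plane} (hA : A ∈ X) (hAM : A ∈ M) {p : BiPoly}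
    (hp : IsFundamental n X A p) : ¬ l ∣ p := by
  rintro ⟨q, rfl⟩
  obtain ⟨⟨m, hm, rfl⟩, hcard⟩ := isMaximalLine_iff.1 hM
  have hd : m ∣ q := by
    apply dvd_of_zeros hm (S := (nodesOn X (zeros m)).erase A)
    · intro B hB
      rw [Finset.mem_erase, mem_nodesOn] at hB
      exact ⟨hB.2.2, eval_right_eq_zero (hlM B hB.2.1 hB.2.2) (hp.2.2 B hB.2.1 hB.1)⟩
    · rw [Finset.card_erase_of_mem (mem_nodesOn.2 ⟨hA, hAM⟩)]
      have h1 := totalDegree_of_eq_mul hl hp.ne_zero rfl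
      have h2 := hp.1
      omega
  have := hp.2.1
  rw [map_mul, eval_eq_zero_of_dvd hd hAM, mul_zero] at this
  exact zero_ne_one this

/-- The fundamental polynomial of any node on `M` vanishes at all `n + 1` nodes of `L`, as many as
its degree allows, without vanishing on the whole of `L`. -/
theorem exists_ratio_of_maximalLine {n : ℕ} {X : Finset Plane} {M L : Set Plane} {l : BiPoly}
    (hl : l.totalDegree = 1) (hLl : L = zeros l) (hM : IsMaximalLine (n + 1) X M)
    (hL : IsMaximalLine n (nodesOff X M) L) (hLM : ∀ A ∈ X, A ∈ M → A ∉ L)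
    {B v : Plane} (hv : v ≠ 0) (hB : B ∈ X) (hBL : B ∈ L)
    (hpar : ∀ Z ∈ L, ∃ t : ℝ, Z = B + t • v)
    (hdvd : ∀ p : BiPoly, lineHom B v p = 0 → l ∣ p) :
    ∃ S : ℝ, ∀ A ∈ X, A ∈ M → ∀ p, IsFundamental (n + 1) X A p →
      (lineHom B v p).coeff 2 = S * (lineHom B v p).coeff 1 ∧ (lineHom B v p).coeff 1 ≠ 0 := by
  choose! t ht using hpar
  have hinj : Set.InjOn t (nodesOn (nodesOff X M) L) := by
    intro x hx y hy hxy
    rw [ht x (mem_nodesOn.1 hx).2, ht y (mem_nodesOn.1 hy).2, hxy]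
  obtain ⟨S, hS⟩ := exists_coeff_two_eq_mul (R := (nodesOn (nodesOff X M) L).image t) (by
    refine Finset.mem_image.2 ⟨B, mem_nodesOn.2 ⟨mem_nodesOff.2 ⟨hB, fun h => hLM B hB h hBL⟩,
      hBL⟩, ?_⟩
    have := ht B hBL
    simpa [hv] using this)
  refine ⟨S, fun A hA hAM p hp => hS _ ?_ ?_ ?_⟩
  · intro h
    exact hp.not_dvd hM hl (hLl ▸ hLM) hA hAM (hdvd p h)
  · rw [Finset.card_image_of_injOn hinj, (isMaximalLine_iff.1 hL).2]
    exact (natDegree_lineHom_le _ _ _).trans hp.1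
  · intro s hs
    obtain ⟨Z, hZ, rfl⟩ := Finset.mem_image.1 hs
    rw [mem_nodesOn, mem_nodesOff] at hZ
    rw [eval_lineHom, ← ht Z hZ.2]
    exact hp.2.2 Z hZ.1.1 fun h => hZ.1.2 (h ▸ hAM)

/-- After removing a maximal line `M`, there are no two distinct maximal lines that
have no node on `M`. -/
theorem IsGC.eq_of_disjoint_maximalLine {n : ℕ} {X : Finset Plane} (hX : IsGC (n + 2) X)
    {M L₁ L₂ : Set Plane} (hM : IsMaximalLine (n + 2) X M)
    (h₁ : IsMaximalLine (n + 1) (nodesOff X M) L₁) (h₂ : IsMaximalLine (n + 1) (nodesOff X M) L₂)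
    (hd₁ : ∀ A ∈ X, A ∈ M → A ∉ L₁) (hd₂ : ∀ A ∈ X, A ∈ M → A ∉ L₂) : L₁ = L₂ := by
  by_contra hne
  have hY := hX.remove hM
  obtain ⟨B, hBY, hB₁, hB₂⟩ := hY.1.exists_mem_inter h₁ h₂
  obtain ⟨hB, hBM⟩ := mem_nodesOff.1 hBY
  obtain ⟨l₁, hl₁, hL₁⟩ := h₁.1
  obtain ⟨l₂, hl₂, hL₂⟩ := h₂.1
  obtain ⟨v, hv, hv0, hv1⟩ := exists_direction hl₁
  obtain ⟨w, hw, hw0, hw1⟩ := exists_direction hl₂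
  obtain ⟨hpar₁, hdvd₁⟩ := hv1 B (hL₁ ▸ hB₁)
  obtain ⟨hpar₂, hdvd₂⟩ := hw1 B (hL₂ ▸ hB₂)
  obtain ⟨S, hS⟩ := exists_ratio_of_maximalLine hl₁ hL₁ hM h₁ hd₁ hv hB hB₁ (hL₁ ▸ hpar₁) hdvd₁
  obtain ⟨T, hT⟩ := exists_ratio_of_maximalLine hl₂ hL₂ hM h₂ hd₂ hw hB hB₂ (hL₂ ▸ hpar₂) hdvd₂
  have e₁ : eval B l₁ = 0 := by rw [hL₁] at hB₁; exact hB₁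
  have e₂ : eval B l₂ = 0 := by rw [hL₂] at hB₂; exact hB₂
  -- `F` measures the failure of the relation in `coeff_two_lineHom_add`; the GC property provides
  -- the linear factor through `B` that makes it vanish.
  let F : BiPoly →ₗ[ℝ] ℝ := Polynomial.lcoeff ℝ 2 ∘ₗ (lineHom B (v + w)).toLinearMap -
    (S + T) • (Polynomial.lcoeff ℝ 1 ∘ₗ (lineHom B v).toLinearMap +
      Polynomial.lcoeff ℝ 1 ∘ₗ (lineHom B w).toLinearMap)
  have hFapp (p : BiPoly) : F p = (lineHom B (v + w) p).coeff 2 -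
      (S + T) * ((lineHom B v p).coeff 1 + (lineHom B w p).coeff 1) := rfl
  have hF : ∀ A ∈ X, A ∈ M → ∀ p, IsFundamental (n + 2) X A p → F p = 0 := by
    intro A hA hAM p hp
    obtain ⟨f, hf, hprod⟩ := hX.2 A hA p hp
    have hpB : eval B p = 0 := hp.2.2 B hB fun h => hBM (h ▸ hAM)
    rw [hprod, map_prod] at hpB
    obtain ⟨i, hi, hfi⟩ := Finset.prod_eq_zero_iff.1 hpB
    obtain ⟨g, hg⟩ : f i ∣ p := hprod ▸ Finset.dvd_prod_of_mem f hi
    obtain ⟨hS1, hS2⟩ := hS A hA hAM p hp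
    obtain ⟨hT1, hT2⟩ := hT A hA hAM p hp
    rw [hFapp, coeff_two_lineHom_add hg (hf i) hfi hS1 hS2 hT1 hT2, sub_self]
  have hZ := hY.1.isMaximalLine_nodesOff h₁ h₂ hne
  -- The remaining nodes are `(n - 1)`-poised, or absent when `n = 0`. If `q` interpolates `1 / l₁`
  -- there, then `1 - l₁ * q` vanishes at them and equals 1 at `B`, where `l₁` is zero.
  obtain ⟨r, hr, hrB, hrZ⟩ : ∃ r : BiPoly, r.totalDegree ≤ n ∧ eval B r = 1 ∧
      ∀ A ∈ nodesOff (nodesOff (nodesOff X M) L₁) L₂, eval A r = 0 := by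
    cases n with
    | zero =>
      refine ⟨1, by simp, by simp, ?_⟩
      have h1 := (hY.1.remove h₁).card_eq_one
      have h2 := (isMaximalLine_iff.1 hZ).2
      have h3 := card_nodesOn_add_card_nodesOff (nodesOff (nodesOff X M) L₁) L₂
      have h4 : (nodesOff (nodesOff (nodesOff X M) L₁) L₂).card = 0 := by omega
      rw [Finset.card_eq_zero] at h4
      simp [h4]
    | succ n =>
      obtain ⟨q, hq, hqe⟩ := ((hY.1.remove h₁).remove hZ).exists_eval_eq
        fun A => (eval A l₁)⁻¹
      refine ⟨1 - l₁ * q, ?_, by simp [e₁], fun A hA => ?_⟩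
      · refine (totalDegree_sub _ _).trans (max_le (by simp) ((totalDegree_mul _ _).trans ?_))
        omega
      · have hA1 : eval A l₁ ≠ 0 := by
          simp only [mem_nodesOff] at hA
          have := hA.1.2
          rw [hL₁] at this
          exact this
        simp [hqe A hA, hA1]
  have hF0 := linearMap_eq_zero hX.1 F hF (p := l₁ * l₂ * r) (by
    have := totalDegree_mul (l₁ * l₂) r
    have := totalDegree_mul l₁ l₂
    omega) (by
    intro A hA
    by_cases hA₁ : A ∈ L₁
    · rw [hL₁] at hA₁
      have : eval A l₁ = 0 := hA₁
      simp [this]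
    by_cases hA₂ : A ∈ L₂
    · rw [hL₂] at hA₂
      have : eval A l₂ = 0 := hA₂
      simp [this]
    simp [hrZ A (mem_nodesOff.2 ⟨mem_nodesOff.2 ⟨hA, hA₁⟩, hA₂⟩)])
  have b₁ : eval (B + v) l₁ = 0 := by simpa [e₁] using hv0 B 1
  have b₂ : eval (B + w) l₂ = 0 := by simpa [e₂] using hw0 B 1
  have c₁ : eval (B + w) l₁ ≠ 0 := by
    intro h
    refine hne (h₁.1.eq_of_mem h₂.1 (A := B) (B := B + w) (by simpa using hw) hB₁ ?_ hB₂ ?_)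
    · rw [hL₁]; exact h
    · rw [hL₂]; exact b₂
  have c₂ : eval (B + v) l₂ ≠ 0 := by
    intro h
    refine hne (h₁.1.eq_of_mem h₂.1 (A := B) (B := B + v) (by simpa using hv) hB₁ ?_ hB₂ ?_)
    · rw [hL₁]; exact b₁
    · rw [hL₂]; exact h
  have d₁ : lineHom B v l₁ = 0 := by simp [lineHom_of_eval_eq_zero hl₁ e₁, b₁]
  have d₂ : lineHom B w l₂ = 0 := by simp [lineHom_of_eval_eq_zero hl₂ e₂, b₂]
  have f₁ := lineHom_of_eval_eq_zero hl₁ e₁ (v + w)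
  have f₂ := lineHom_of_eval_eq_zero hl₂ e₂ (v + w)
  rw [eval_add_of_eval_eq_zero hl₁ e₁, b₁, zero_add] at f₁
  rw [eval_add_of_eval_eq_zero hl₂ e₂, b₂, add_zero] at f₂
  -- The product `l₁ * l₂ * r` is zero on both lines, so only the coefficient along `v + w`
  -- survives. It equals `l₁ (B + w) * l₂ (B + v) * r B`, which is nonzero.
  rw [hFapp] at hF0
  simp only [map_mul, d₁, d₂, f₁, f₂, zero_mul, mul_zero, Polynomial.coeff_zero, add_zero,
    sub_zero] at hF0
  have : (Polynomial.C (eval (B + w) l₁) * Polynomial.X * (Polynomial.C (eval (B + v) l₂) *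
      Polynomial.X) * lineHom B (v + w) r) = Polynomial.C (eval (B + w) l₁ * eval (B + v) l₂) *
      (Polynomial.X * (Polynomial.X * lineHom B (v + w) r)) := by
    rw [Polynomial.C_mul]; ring
  rw [this, Polynomial.coeff_C_mul, Polynomial.coeff_X_mul, Polynomial.coeff_X_mul,
    coeff_zero_lineHom, hrB, mul_one] at hF0
  exact mul_ne_zero c₁ c₂ hF0

/-! ### Existence of three maximal lines -/

theorem IsPoised.isMaximalLine_join {X : Finset Plane} (hX : IsPoised 1 X) {A B : Plane}
    (hA : A ∈ X) (hB : B ∈ X) (hAB : A ≠ B) : IsMaximalLine 1 X (join A B) := by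
  rw [isMaximalLine_iff]
  refine ⟨isLine_join hAB, le_antisymm (hX.card_nodesOn_le (isLine_join hAB)) ?_⟩
  change 2 ≤ _
  rw [← Finset.card_pair hAB]
  refine Finset.card_le_card fun Z hZ => ?_
  rcases Finset.mem_insert.1 hZ with rfl | hZ
  · exact mem_nodesOn.2 ⟨hA, left_mem_join _ _⟩
  · rw [Finset.mem_singleton.1 hZ]
    exact mem_nodesOn.2 ⟨hB, right_mem_join _ _⟩

theorem IsPoised.notMem_join {X : Finset Plane} (hX : IsPoised 1 X) {A B D : Plane}
    (hA : A ∈ X) (hB : B ∈ X) (hD : D ∈ X) (hAB : A ≠ B) (hAD : A ≠ D) (hBD : B ≠ D) :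
    D ∉ join A B := by
  intro h
  have h1 := hX.card_nodesOn_le (isLine_join hAB)
  have h2 : ({A, B, D} : Finset Plane).card = 3 := Finset.card_eq_three.2
    ⟨A, B, D, hAB, hAD, hBD, rfl⟩
  have h3 : ({A, B, D} : Finset Plane) ⊆ nodesOn X (join A B) := by
    intro Z hZ
    simp only [Finset.mem_insert, Finset.mem_singleton] at hZ
    rcases hZ with rfl | rfl | rfl
    · exact mem_nodesOn.2 ⟨hA, left_mem_join _ _⟩
    · exact mem_nodesOn.2 ⟨hB, right_mem_join _ _⟩
    · exact mem_nodesOn.2 ⟨hD, h⟩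
  have := Finset.card_le_card h3
  omega

theorem maximalLine_or_disjoint {n : ℕ} {X : Finset Plane} {M L : Set Plane} (hM : IsLine M)
    (hL : IsMaximalLine n (nodesOff X M) L) :
    IsMaximalLine (n + 1) X L ∨ ∀ A ∈ X, A ∈ M → A ∉ L := by
  rw [or_iff_not_imp_right]
  intro h
  push Not at h
  obtain ⟨A, hA, hAM, hAL⟩ := h
  rw [isMaximalLine_iff] at *
  have hne : L ≠ M := by
    rintro rfl
    have h0 : nodesOn (nodesOff X L) L = ∅ := by ext; simp
    rw [h0] at hL
    simp at hL
  have := card_nodesOn_nodesOff_of_mem hL.1 hM hne hA hAL hAM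
  exact ⟨hL.1, by omega⟩

theorem ne_of_isMaximalLine_nodesOff {n : ℕ} {X : Finset Plane} {M L : Set Plane}
    (hL : IsMaximalLine n (nodesOff X M) L) : M ≠ L := by
  rintro rfl
  have h0 : nodesOn (nodesOff X M) M = ∅ := by ext; simp
  have h1 := (isMaximalLine_iff.1 hL).2
  rw [h0] at h1
  simp at h1

/-- Of three maximal lines of `X \ M`, at most one has no node on `M`. The other two are maximal in
`X` and join `M`. -/
theorem IsGC.exists_three_maximalLines {n : ℕ} (hn : 1 ≤ n)
    (hGM : ∀ k : ℕ, 1 ≤ k → k ≤ n → GascaMaeztu k) {X : Finset Plane} (hX : IsGC n X) :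
    ∃ M₁ M₂ M₃ : Set Plane, IsMaximalLine n X M₁ ∧ IsMaximalLine n X M₂ ∧ IsMaximalLine n X M₃ ∧
      M₁ ≠ M₂ ∧ M₁ ≠ M₃ ∧ M₂ ≠ M₃ := by
  induction n, hn using Nat.le_induction generalizing X with
  | base =>
    have hc := hX.card_eq hGM
    obtain ⟨A, B, D, hAB, hAD, hBD, rfl⟩ := Finset.card_eq_three.1 (hc.trans (by rfl))
    have hA : A ∈ ({A, B, D} : Finset Plane) := by simp
    have hB : B ∈ ({A, B, D} : Finset Plane) := by simp
    have hD : D ∈ ({A, B, D} : Finset Plane) := by simp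
    have h := hX.1.notMem_join hA hB hD hAB hAD hBD
    have h' := hX.1.notMem_join hA hD hB hAD hAB hBD.symm
    refine ⟨join A B, join A D, join B D, hX.1.isMaximalLine_join hA hB hAB,
      hX.1.isMaximalLine_join hA hD hAD, hX.1.isMaximalLine_join hB hD hBD, ?_, ?_, ?_⟩
    · exact fun e => h (e ▸ right_mem_join A D)
    · exact fun e => h (e ▸ right_mem_join B D)
    · exact fun e => h' (e ▸ left_mem_join B D)
  | succ n hn ih =>
    obtain ⟨k, rfl⟩ : ∃ k, n = k + 1 := ⟨n - 1, by omega⟩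
    obtain ⟨M, hM⟩ := hGM (k + 2) (by omega) le_rfl X hX
    obtain ⟨L₁, L₂, L₃, h₁, h₂, h₃, h₁₂, h₁₃, h₂₃⟩ :=
      ih (fun j h1 h2 => hGM j h1 (by omega)) (hX.remove hM)
    have n₁ := ne_of_isMaximalLine_nodesOff h₁
    have n₂ := ne_of_isMaximalLine_nodesOff h₂
    have n₃ := ne_of_isMaximalLine_nodesOff h₃
    rcases maximalLine_or_disjoint hM.1 h₁ with a₁ | a₁
    · rcases maximalLine_or_disjoint hM.1 h₂ with a₂ | a₂
      · exact ⟨M, L₁, L₂, hM, a₁, a₂, n₁, n₂, h₁₂⟩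
      · rcases maximalLine_or_disjoint hM.1 h₃ with a₃ | a₃
        · exact ⟨M, L₁, L₃, hM, a₁, a₃, n₁, n₃, h₁₃⟩
        · exact absurd (hX.eq_of_disjoint_maximalLine hM h₂ h₃ a₂ a₃) h₂₃
    · rcases maximalLine_or_disjoint hM.1 h₂ with a₂ | a₂
      · rcases maximalLine_or_disjoint hM.1 h₃ with a₃ | a₃
        · exact ⟨M, L₂, L₃, hM, a₂, a₃, n₂, n₃, h₂₃⟩
        · exact absurd (hX.eq_of_disjoint_maximalLine hM h₁ h₃ a₁ a₃) h₁₃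
      · exact absurd (hX.eq_of_disjoint_maximalLine hM h₁ h₂ a₁ a₂) h₁₂

/-! ### The dichotomy: low degrees and the induction step -/

/-- Some maximal line meets `L` in no node, or two maximal lines meet at a node of `L`. -/
def Dichotomy (n : ℕ) (X : Finset Plane) (L : Set Plane) : Prop :=
  (∃ M, IsMaximalLine n X M ∧ ∀ A ∈ X, A ∈ M → A ∉ L) ∨
    ∃ M M' A, IsMaximalLine n X M ∧ IsMaximalLine n X M' ∧ M ≠ M' ∧ A ∈ X ∧ A ∈ M ∧ A ∈ M' ∧ A ∈ L

theorem dichotomy_of_le_two {n : ℕ} (hn : 1 ≤ n) (hn2 : n ≤ 2)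
    (hGM : ∀ k : ℕ, 1 ≤ k → k ≤ n → GascaMaeztu k) {X : Finset Plane} (hX : IsGC n X)
    {L : Set Plane} (hL : IsNodeLine n X L) : Dichotomy n X L := by
  obtain ⟨M₁, M₂, M₃, h₁, h₂, h₃, h₁₂, h₁₃, h₂₃⟩ := hX.exists_three_maximalLines hn hGM
  by_contra hno
  simp only [Dichotomy, not_or, not_exists, not_and, not_forall, not_not] at hno
  obtain ⟨hmeet, hconc⟩ := hno
  obtain ⟨A₁, a₁, b₁, c₁⟩ := hmeet M₁ h₁
  obtain ⟨A₂, a₂, b₂, c₂⟩ := hmeet M₂ h₂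
  obtain ⟨A₃, a₃, b₃, c₃⟩ := hmeet M₃ h₃
  have e₁₂ : A₁ ≠ A₂ := by rintro rfl; exact hconc _ _ _ h₁ h₂ h₁₂ a₁ b₁ b₂ c₁
  have e₁₃ : A₁ ≠ A₃ := by rintro rfl; exact hconc _ _ _ h₁ h₃ h₁₃ a₁ b₁ b₃ c₁
  have e₂₃ : A₂ ≠ A₃ := by rintro rfl; exact hconc _ _ _ h₂ h₃ h₂₃ a₂ b₂ b₃ c₂
  have h3 : ({A₁, A₂, A₃} : Finset Plane).card = 3 := Finset.card_eq_three.2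
    ⟨_, _, _, e₁₂, e₁₃, e₂₃, rfl⟩
  have hs : ({A₁, A₂, A₃} : Finset Plane) ⊆ nodesOn X L := by
    intro Z hZ
    simp only [Finset.mem_insert, Finset.mem_singleton] at hZ
    rcases hZ with rfl | rfl | rfl <;> simp [*]
  have := Finset.card_le_card hs
  have := (isNodeLine_iff.1 hL).2
  omega

theorem dichotomy_succ {m : ℕ} (ih : ∀ (Y : Finset Plane) (L : Set Plane), IsGC (m + 3) Y →
      IsNodeLine (m + 3) Y L → Dichotomy (m + 3) Y L)
    (hGM : ∀ k : ℕ, 1 ≤ k → k ≤ m + 4 → GascaMaeztu k) {X : Finset Plane} (hX : IsGC (m + 4) X)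
    {L : Set Plane} (hL : IsNodeLine (m + 4) X L) : Dichotomy (m + 4) X L := by
  by_contra hno
  simp only [Dichotomy, not_or, not_exists, not_and, not_forall, not_not] at hno
  obtain ⟨hmeet, hconc⟩ := hno
  rw [isNodeLine_iff] at hL
  have hneL : ∀ M, IsMaximalLine (m + 4) X M → L ≠ M := by
    rintro M hM rfl
    have := (isMaximalLine_iff.1 hM).2
    omega
  have hrem : ∀ M, IsMaximalLine (m + 4) X M → (nodesOn (nodesOff X M) L).card = m + 3 := by
    intro M hM
    obtain ⟨A, hA, hAM, hAL⟩ := hmeet M hM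
    have := card_nodesOn_nodesOff_of_mem hL.1 hM.1 (hneL M hM) hA hAL hAM
    omega
  -- The dichotomy for `X \ M` must involve a line `N` that is not maximal in `X`, since otherwise
  -- it would already hold in `X`. If `N` has a node on `L`, that node lies on a maximal line `M'`
  -- of `X`; if not, `M'` is any other maximal line.
  have hexN : ∀ M, IsMaximalLine (m + 4) X M → ∃ N M', IsMaximalLine (m + 3) (nodesOff X M) N ∧
      (∀ A ∈ X, A ∈ M → A ∉ N) ∧ IsMaximalLine (m + 4) X M' ∧ M' ≠ M ∧
      ((∀ A ∈ X, A ∈ N → A ∉ L) ∨ ∃ A ∈ X, A ∈ N ∧ A ∈ M' ∧ A ∈ L) := by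
    intro M hM
    rcases ih (nodesOff X M) L (hX.remove hM) (isNodeLine_iff.2 ⟨hL.1, hrem M hM⟩) with
      ⟨N, hN, hd⟩ | ⟨N, N', A, hN, hN', hne, hA, hAN, hAN', hAL⟩
    · have hN' : ∀ A ∈ X, A ∈ M → A ∉ N := by
        refine (maximalLine_or_disjoint hM.1 hN).resolve_left fun h => ?_
        obtain ⟨A, hA, hAN, hAL⟩ := hmeet N h
        have hAM : A ∈ M := by
          by_contra hAM
          exact hd A (mem_nodesOff.2 ⟨hA, hAM⟩) hAN hAL
        exact hconc M N A hM h (ne_of_isMaximalLine_nodesOff hN) hA hAM hAN hAL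
      obtain ⟨M', hM', hne⟩ : ∃ M', IsMaximalLine (m + 4) X M' ∧ M' ≠ M := by
        obtain ⟨M₁, M₂, M₃, h₁, h₂, -, h₁₂, -, -⟩ :=
          hX.exists_three_maximalLines (by omega) hGM
        by_cases h : M₁ = M
        · exact ⟨M₂, h₂, h ▸ h₁₂.symm⟩
        · exact ⟨M₁, h₁, h⟩
      exact ⟨N, M', hN, hN', hM', hne, Or.inl fun A hA hAN =>
        hd A (mem_nodesOff.2 ⟨hA, fun hAM => hN' A hA hAM hAN⟩) hAN⟩
    · rw [mem_nodesOff] at hA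
      rcases maximalLine_or_disjoint hM.1 hN with h | h
      · rcases maximalLine_or_disjoint hM.1 hN' with h' | h'
        · exact (hconc N N' A h h' hne hA.1 hAN hAN' hAL).elim
        · exact ⟨N', N, hN', h', h, (ne_of_isMaximalLine_nodesOff hN).symm,
            Or.inr ⟨A, hA.1, hAN', hAN, hAL⟩⟩
      · rcases maximalLine_or_disjoint hM.1 hN' with h' | h'
        · exact ⟨N, N', hN, h, h', (ne_of_isMaximalLine_nodesOff hN').symm,
            Or.inr ⟨A, hA.1, hAN, hAN', hAL⟩⟩
        · exact (hne (hX.eq_of_disjoint_maximalLine hM hN hN' h h')).elim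
  obtain ⟨M₁, hM₁⟩ := hGM (m + 4) (by omega) le_rfl X hX
  obtain ⟨N₁, M₂, hN₁, hd₁, hM₂, hne, ht₁⟩ := hexN M₁ hM₁
  obtain ⟨N₂, M₃, hN₂, hd₂, hM₃, hne₃, ht₂⟩ := hexN M₂ hM₂
  have hY := hX.remove hM₁
  have hM₂Y := hX.1.isMaximalLine_nodesOff hM₁ hM₂ hne.symm
  have hW := hY.remove hM₂Y
  have hM₂N₁ : M₂ ≠ N₁ := by
    rintro rfl
    obtain ⟨A, hA, h1, h2⟩ := hX.1.exists_mem_inter hM₁ hM₂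
    exact hd₁ A hA h1 h2
  have hM₁N₂ : M₁ ≠ N₂ := by
    rintro rfl
    obtain ⟨A, hA, h1, h2⟩ := hX.1.exists_mem_inter hM₁ hM₂
    exact hd₂ A hA h2 h1
  have hN₁W := hY.1.isMaximalLine_nodesOff hM₂Y hN₁ hM₂N₁
  have hN₂W : IsMaximalLine (m + 2) (nodesOff (nodesOff X M₁) M₂) N₂ := by
    rw [nodesOff_comm]
    exact (hX.remove hM₂).1.isMaximalLine_nodesOff
      (hX.1.isMaximalLine_nodesOff hM₂ hM₁ hne) hN₂ hM₁N₂
  -- `N₁` shares a node with `M₂`, while `N₂` has none there.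
  have hN₁₂ : N₁ ≠ N₂ := by
    rintro rfl
    obtain ⟨A, hA, h1, h2⟩ := hY.1.exists_mem_inter hM₂Y hN₁
    exact hd₂ A (mem_nodesOff.1 hA).1 h1 h2
  have hU := hW.remove hN₁W
  have hN₂U := hW.1.isMaximalLine_nodesOff hN₁W hN₂W hN₁₂
  have hN₁L : ∀ A ∈ nodesOff (nodesOff X M₁) M₂, A ∈ L → A ∉ N₁ := by
    intro A hA hAL hAN
    simp only [mem_nodesOff] at hA
    rcases ht₁ with h | ⟨B, hB, hBN, hBM, hBL⟩
    · exact h A hA.1.1 hAN hAL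
    · have hAB : A ≠ B := fun h => hA.2 (h ▸ hBM)
      have hNL : N₁ = L := hN₁.1.eq_of_mem hL.1 hAB hAN hBN hAL hBL
      obtain ⟨Z, hZ, hZM, hZL⟩ := hmeet M₁ hM₁
      exact hd₁ Z hZ hZM (hNL ▸ hZL)
  -- `M₁` and `M₂` each take one node off `L`, and `N₁` takes none, since any node it shares with
  -- `L` lies on `M₂`. Thus `m + 2` nodes of `L` remain in degree `m + 1`.
  have hLU : IsMaximalLine (m + 1) (nodesOff (nodesOff (nodesOff X M₁) M₂) N₁) L := by
    rw [isMaximalLine_iff, nodesOn_nodesOff_of_disjoint hN₁L]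
    refine ⟨hL.1, ?_⟩
    obtain ⟨Z, hZ, hZM, hZL⟩ := hmeet M₂ hM₂
    have hZ₁ : Z ∉ M₁ := fun h => hconc M₂ M₁ Z hM₂ hM₁ hne hZ hZM h hZL
    have h1 := card_nodesOn_nodesOff_of_mem hL.1 hM₂.1 (hneL M₂ hM₂)
      (mem_nodesOff.2 ⟨hZ, hZ₁⟩) hZL hZM
    have h2 := hrem M₁ hM₁
    omega
  have hLN₂ : L ≠ N₂ := by
    rintro rfl
    obtain ⟨Z, hZ, hZM, hZL⟩ := hmeet M₂ hM₂
    exact hd₂ Z hZ hZM hZL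
  obtain ⟨A, hA, hAL, hAN₂⟩ := hU.1.exists_mem_inter hLU hN₂U
  simp only [mem_nodesOff] at hA
  obtain ⟨⟨⟨hA, hAM₁⟩, hAM₂⟩, hAN₁⟩ := hA
  rcases ht₂ with h | ⟨B, hB, hBN, hBM, hBL⟩
  · exact h A hA hAN₂ hAL
  · have hAB : A = B := by
      by_contra hAB
      exact hLN₂ (hL.1.eq_of_mem hN₂.1 hAB hAL hBL hAN₂ hBN)
    subst hAB
    have h₁₃ : M₁ ≠ M₃ := fun h => hAM₁ (h ▸ hBM)
    have hM₃Y := hX.1.isMaximalLine_nodesOff hM₁ hM₃ h₁₃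
    have hM₃W := hY.1.isMaximalLine_nodesOff hM₂Y hM₃Y hne₃.symm
    have hM₃U := hW.1.isMaximalLine_nodesOff hN₁W hM₃W fun h => hAN₁ (h ▸ hBM)
    -- The common node of `L` and `N₂` also lies on `M₃`, giving three concurrent maximal lines in
    -- the positive degree `m + 1`.
    refine hU.1.not_concurrent hLU hN₂U hM₃U hLN₂ (hneL M₃ hM₃) ?_ hAL hAN₂ hBM
    rintro rfl
    obtain ⟨Z, hZ, h1, h2⟩ := hX.1.exists_mem_inter hM₂ hM₃
    exact hd₂ Z hZ h1 h2

/-! ### Degree four: a triangle covered by three lines -/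

theorem exists_labels_of_cover {g : Fin 3 → Set Plane} {F : Finset Plane} {x y z : Plane}
    (hx : x ∈ F) (hy : y ∈ F) (hz : z ∈ F) (hxy : x ≠ y) (hxz : x ≠ z) (hyz : y ≠ z)
    (hcov : ∀ A ∈ F, ∃ s, A ∈ g s) (hinj : ∀ s, ∀ A ∈ F, ∀ B ∈ F, A ∈ g s → B ∈ g s → A = B) :
    ∃ sx sy sz : Fin 3, x ∈ g sx ∧ y ∈ g sy ∧ z ∈ g sz ∧ sx ≠ sy ∧ sx ≠ sz ∧ sy ≠ sz := by
  obtain ⟨sx, hsx⟩ := hcov x hx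
  obtain ⟨sy, hsy⟩ := hcov y hy
  obtain ⟨sz, hsz⟩ := hcov z hz
  refine ⟨sx, sy, sz, hsx, hsy, hsz, ?_, ?_, ?_⟩
  · rintro rfl; exact hxy (hinj _ x hx y hy hsx hsy)
  · rintro rfl; exact hxz (hinj _ x hx z hz hsx hsz)
  · rintro rfl; exact hyz (hinj _ y hy z hz hsy hsz)

theorem eq_or_eq_or_eq_of_ne {a b c : Fin 3} (hab : a ≠ b) (hac : a ≠ c) (hbc : b ≠ c) (s : Fin 3) :
    s = a ∨ s = b ∨ s = c := by omega

theorem join_ne_join {P Q R : Plane} (hPQR : R ∉ join P Q) : join P Q ≠ join P R :=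
  fun h => hPQR (h ▸ right_mem_join P R)

/-- Three lines cover the triangle `P Q R` and the triples `F`, `G`, each of them passing through
at most one point of either triple. -/
def CoveredByThree (F G : Finset Plane) (P Q R : Plane) : Prop :=
  ∃ g : Fin 3 → Set Plane, (∀ s, IsLine (g s)) ∧
    (∀ s, ∀ A ∈ F, ∀ B ∈ F, A ∈ g s → B ∈ g s → A = B) ∧
    (∀ s, ∀ A ∈ G, ∀ B ∈ G, A ∈ g s → B ∈ g s → A = B) ∧
    (∀ A ∈ F, ∃ s, A ∈ g s) ∧ (∀ A ∈ G, ∃ s, A ∈ g s) ∧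
    (∃ s, P ∈ g s) ∧ (∃ s, Q ∈ g s) ∧ ∃ s, R ∈ g s

/-- Three lines that cover a triangle `P Q R` and two triples `F`, `G` of points, with at most one
point of each triple on each line, restrict where the sides of the triangle meet `F` and `G`. -/
theorem collinear_of_cover {L : Set Plane} (hL : IsLine L) {F G : Finset Plane} (hG : G.card = 3)
    {P Q R x y a a' b b'' : Plane} (hxF : x ∈ F) (hyG : y ∈ G) (hxL : x ∈ L) (hyL : y ∈ L)
    (hPL : P ∈ L) (hQL : Q ∉ L) (hRL : R ∉ L) (hPQR : R ∉ join P Q)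
    (hPQ : P ≠ Q) (hPR : P ≠ R) (hQR : Q ≠ R) (hFG : Disjoint F G)
    (hPF : P ∉ F) (hQF : Q ∉ F) (hRF : R ∉ F) (hPG : P ∉ G) (hQG : Q ∉ G) (hRG : R ∉ G)
    (hcov : CoveredByThree F G P Q R)
    (hmF : ∀ A ∈ F, A ∉ join Q R) (hmG : ∀ A ∈ G, A ∉ join P R)
    (haF : a ∈ F) (ha : a ∈ join P Q) (hbG : b ∈ G) (hb : b ∈ join P Q)
    (haF' : a' ∈ F) (ha' : a' ∈ join P R) (hbG'' : b'' ∈ G) (hb'' : b'' ∈ join Q R) :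
    y ∈ join Q R ∧ ∃ b' ∈ G, b' ≠ b ∧ b' ≠ y ∧ b' ∈ join R x ∧
      ∀ z ∈ G, z = b ∨ z = y ∨ z = b' := by
  have lPQ := isLine_join hPQ
  have lPR := isLine_join hPR
  have lQR := isLine_join hQR
  have ne {S : Finset Plane} {A B : Plane} (hA : A ∈ S) (hB : B ∉ S) : A ≠ B :=
    fun h => hB (h ▸ hA)
  have hxa : x ≠ a := by
    rintro rfl
    have := hL.eq_of_mem lPQ (ne hxF hPF) hxL hPL ha (left_mem_join _ _)
    exact hQL (this ▸ right_mem_join _ _)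
  have hxa' : x ≠ a' := by
    rintro rfl
    have := hL.eq_of_mem lPR (ne hxF hPF) hxL hPL ha' (left_mem_join _ _)
    exact hRL (this ▸ right_mem_join _ _)
  have haa' : a ≠ a' := by
    rintro rfl
    exact join_ne_join hPQR (lPQ.eq_of_mem lPR (ne haF hPF) ha (left_mem_join _ _) ha'
      (left_mem_join _ _))
  have hyb : y ≠ b := by
    rintro rfl
    have := hL.eq_of_mem lPQ (ne hyG hPG) hyL hPL hb (left_mem_join _ _)
    exact hQL (this ▸ right_mem_join _ _)
  have hab : a ≠ b := fun h => Finset.disjoint_left.1 hFG haF (h ▸ hbG)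
  have hxy : x ≠ y := fun h => Finset.disjoint_left.1 hFG hxF (h ▸ hyG)
  obtain ⟨b', hb', hGz⟩ : ∃ b' ∈ (G.erase b).erase y, ∀ z ∈ G, z = b ∨ z = y ∨ z = b' := by
    have hc : ((G.erase b).erase y).card = 1 := by
      rw [Finset.card_erase_of_mem (Finset.mem_erase.2 ⟨hyb, hyG⟩), Finset.card_erase_of_mem hbG, hG]
    obtain ⟨b', hb'⟩ := Finset.card_eq_one.1 hc
    refine ⟨b', by simp [hb'], fun z hz => ?_⟩
    by_contra! h
    have : z ∈ (G.erase b).erase y := by simp [h, hz]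
    rw [hb', Finset.mem_singleton] at this
    exact h.2.2 this
  simp only [Finset.mem_erase] at hb'
  obtain ⟨hby', hbb', hbG'⟩ := hb'
  obtain ⟨g, hg, injF, injG, covF, covG, ⟨sP, hsP⟩, ⟨sQ, hsQ⟩, ⟨sR, hsR⟩⟩ := hcov
  obtain ⟨sx, sa, sa', hsx, hsa, hsa', n1, n2, n3⟩ :=
    exists_labels_of_cover hxF haF haF' hxa hxa' haa' covF injF
  obtain ⟨ty, tb, tb', hty, htb, htb', m1, m2, m3⟩ :=
    exists_labels_of_cover hyG hbG hbG' hyb hby'.symm hbb'.symm covG injG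
  have sF := eq_or_eq_or_eq_of_ne n1 n2 n3
  have sG := eq_or_eq_or_eq_of_ne m1 m2 m3
  have hitG (s : Fin 3) : ∃ Z ∈ G, Z ∈ g s := by
    rcases sG s with rfl | rfl | rfl
    · exact ⟨y, hyG, hty⟩
    · exact ⟨b, hbG, htb⟩
    · exact ⟨b', hbG', htb'⟩
  -- Each covering line carries exactly one point of `G`, while the side `P R` has none.
  have noPR (s : Fin 3) : g s ≠ join P R := by
    intro h
    obtain ⟨Z, hZ, hZs⟩ := hitG s
    exact hmG Z hZ (h ▸ hZs)
  have hPa' : sP ≠ sa' := by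
    rintro rfl
    exact noPR _ ((hg _).eq_of_mem lPR (ne haF' hPF) hsa' hsP ha' (left_mem_join _ _))
  have hRa' : sR ≠ sa' := by
    rintro rfl
    exact noPR _ ((hg _).eq_of_mem lPR (ne haF' hRF) hsa' hsR ha' (right_mem_join _ _))
  have hRa : g sa = join P Q → sR ≠ sa := by
    rintro h rfl
    exact hPQR (h ▸ hsR)
  -- If the line through `P` and `x` were used it would be `L`, which also contains `y`. Whichever
  -- line then covers `Q`, one of the other two is the side `P Q`, and nothing is left to cover `R`.
  have hPx : sP ≠ sx := by
    rintro rfl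
    have hgL : g sP = L := (hg _).eq_of_mem hL (ne hxF hPF) hsx hsP hxL hPL
    have hyP : ty = sP := by
      by_contra hne
      have hy' : y ∈ g sP := hgL ▸ hyL
      rcases sG sP with h | h | h
      · exact hne h.symm
      · exact hyb (injG sP y hyG b hbG hy' (h ▸ htb))
      · exact hby' (injG sP y hyG b' hbG' hy' (h ▸ htb')).symm
    have hRP : sR ≠ sP := by rintro rfl; exact hRL (hgL ▸ hsR)
    have hQP : sQ ≠ sP := by rintro rfl; exact hQL (hgL ▸ hsQ)
    rcases sF sQ with h | h | h
    · exact hQP h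
    · subst h
      have h1 := (hg _).eq_of_mem lPQ (ne haF hQF) hsa hsQ ha (right_mem_join _ _)
      rcases sF sR with h | h | h
      · exact hRP h
      · exact hRa h1 h
      · exact hRa' h
    · subst h
      have hQtb : tb ≠ sQ := by
        rintro rfl
        have h1 := (hg _).eq_of_mem lPQ (ne hbG hQG) htb hsQ hb (right_mem_join _ _)
        exact haa' (injF _ a haF a' haF' (h1 ▸ ha) hsa')
      have hab' : sa = tb := by
        rcases sF tb with h | h | h
        · exact absurd (hyP.trans h.symm) m1
        · exact h.symm
        · exact absurd h hQtb
      have h1 := (hg _).eq_of_mem lPQ hab hsa (hab' ▸ htb) ha hb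
      rcases sF sR with h | h | h
      · exact hRP h
      · exact hRa h1 h
      · exact hRa' h
  have hPa : sP = sa := by
    rcases sF sP with h | h | h
    · exact absurd h hPx
    · exact h
    · exact absurd h hPa'
  subst hPa
  have h1 := (hg _).eq_of_mem lPQ (ne haF hPF) hsa hsP ha (left_mem_join _ _)
  have hRx : sR = sx := by
    rcases sF sR with h | h | h
    · exact h
    · exact absurd h (hRa h1)
    · exact absurd h hRa'
  subst hRx
  -- The covering lines are now the side `P Q` through `a` and `b`, the line `R x`, and one through
  -- `a'`. A point `y` on `R x` would turn it into `L`, so its point of `G` is `b'`.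
  have hbR : b' ∈ g sR := by
    rcases sG sR with h | h | h
    · have h2 := (hg _).eq_of_mem hL hxy hsx (h ▸ hty) hxL hyL
      exact absurd (h2 ▸ hsR) hRL
    · rcases sG sP with h' | h' | h'
      · exact absurd (injG sP y hyG b hbG (h' ▸ hty) (h1 ▸ hb)) hyb
      · exact absurd (h'.trans h.symm) n1.symm
      · exact absurd (injG sP b' hbG' b hbG (h' ▸ htb') (h1 ▸ hb)) hbb'
    · exact h ▸ htb'
  have h2 := (hg _).eq_join (ne hxF hRF).symm hsR hsx
  refine ⟨?_, b', hbG', hbb', hby', h2 ▸ hbR, hGz⟩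
  rcases hGz b'' hbG'' with rfl | rfl | rfl
  · have h3 := lPQ.eq_of_mem lQR (ne hbG'' hQG) hb (right_mem_join _ _) hb'' (left_mem_join _ _)
    exact absurd (h3 ▸ right_mem_join _ _) hPQR
  · exact hb''
  · have h3 := (hg _).eq_of_mem lQR (ne hbG'' hRG) hbR hsR hb'' (right_mem_join _ _)
    exact absurd (h3 ▸ hsx) (hmF x hxF)

theorem CoveredByThree.swap {F G : Finset Plane} {P Q R : Plane} (h : CoveredByThree F G P Q R) :
    CoveredByThree F G P R Q := by
  obtain ⟨g, h1, h2, h3, h4, h5, h6, h7, h8⟩ := h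
  exact ⟨g, h1, h2, h3, h4, h5, h6, h8, h7⟩

/-- `collinear_of_cover` puts `x j` on `Q R`, so `x k` is not on it for the third index `k`. This
forces all three sides to meet `F k`, in points different from each other and from `x k`: four
points in a triple. -/
theorem false_of_sides_miss {L : Set Plane} (hL : IsLine L) {F : Fin 3 → Finset Plane}
    (hF : ∀ i, (F i).card = 3) (hdisj : ∀ i j, i ≠ j → Disjoint (F i) (F j)) {x : Fin 3 → Plane}
    (hx : ∀ i, x i ∈ F i) (hxL : ∀ i, x i ∈ L) {P Q R : Plane} (hPL : P ∈ L) (hQL : Q ∉ L)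
    (hRL : R ∉ L) (hPQR : R ∉ join P Q) (hPRQ : Q ∉ join P R) (hPQ : P ≠ Q) (hPR : P ≠ R)
    (hQR : Q ≠ R) (hPF : ∀ i, P ∉ F i) (hQF : ∀ i, Q ∉ F i) (hRF : ∀ i, R ∉ F i)
    (hcov : ∀ i j, i ≠ j → CoveredByThree (F i) (F j) P Q R)
    (h₁₂ : ∀ i, (∃ A ∈ F i, A ∈ join P Q) ∨ ∃ A ∈ F i, A ∈ join P R)
    (h₁₃ : ∀ i, (∃ A ∈ F i, A ∈ join P Q) ∨ ∃ A ∈ F i, A ∈ join Q R)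
    (h₂₃ : ∀ i, (∃ A ∈ F i, A ∈ join P R) ∨ ∃ A ∈ F i, A ∈ join Q R)
    {i j : Fin 3} (hi : ∀ A ∈ F i, A ∉ join Q R) (hj : ∀ A ∈ F j, A ∉ join P R) : False := by
  have lPQ := isLine_join hPQ
  have lPR := isLine_join hPR
  have lQR := isLine_join hQR
  have ne {S : Finset Plane} {A B : Plane} (hA : A ∈ S) (hB : B ∉ S) : A ≠ B :=
    fun h => hB (h ▸ hA)
  have miss {e : Set Plane} {k : Fin 3} (h : ∀ A ∈ F k, A ∉ e) : ¬ ∃ A ∈ F k, A ∈ e :=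
    fun ⟨A, hA, hAe⟩ => h A hA hAe
  have hij : i ≠ j := by
    rintro rfl
    exact (h₂₃ i).elim (miss hj) (miss hi)
  have xne {a b : Fin 3} (hab : a ≠ b) : x a ≠ x b :=
    fun h => Finset.disjoint_left.1 (hdisj a b hab) (hx a) (h ▸ hx b)
  obtain ⟨k, hki, hkj⟩ : ∃ k : Fin 3, k ≠ i ∧ k ≠ j :=
    (by decide : ∀ i j : Fin 3, i ≠ j → ∃ k, k ≠ i ∧ k ≠ j) i j hij
  obtain ⟨a, haF, ha⟩ := (h₁₃ i).resolve_right (miss hi)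
  obtain ⟨a', haF', ha'⟩ := (h₂₃ i).resolve_right (miss hi)
  obtain ⟨b, hbF, hb⟩ := (h₁₂ j).resolve_right (miss hj)
  obtain ⟨b'', hbF'', hb''⟩ := (h₂₃ j).resolve_left (miss hj)
  obtain ⟨hxj, b', hbF', hbb', hbx', hbR, hlist⟩ := collinear_of_cover hL (hF j) (hx i) (hx j)
    (hxL i) (hxL j) hPL hQL hRL hPQR hPQ hPR hQR (hdisj i j hij) (hPF i) (hQF i) (hRF i) (hPF j)
    (hQF j) (hRF j) (hcov i j hij) hi hj haF ha hbF hb haF' ha' hbF'' hb''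
  have hxk : x k ∉ join Q R := by
    intro h
    have := hL.eq_of_mem lQR (xne hkj) (hxL k) (hxL j) h hxj
    exact hQL (this ▸ left_mem_join _ _)
  -- Otherwise the lemma applies to both pairs `(i, j)` and `(k, j)` with the same third point `b'`
  -- of `F j`. The lines `R (x i)` and `R (x k)` share it, so they coincide with `L`, contrary to `R
  -- ∉ L`.
  have hitQR : ∃ A ∈ F k, A ∈ join Q R := by
    by_contra hno
    have hk : ∀ A ∈ F k, A ∉ join Q R := fun A hA h => hno ⟨A, hA, h⟩
    obtain ⟨c, hcF, hc⟩ := (h₁₃ k).resolve_right hno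
    obtain ⟨c', hcF', hc'⟩ := (h₂₃ k).resolve_right hno
    obtain ⟨-, d, hdF, hdb, hdx, hdR, -⟩ := collinear_of_cover hL (hF j) (hx k) (hx j)
      (hxL k) (hxL j) hPL hQL hRL hPQR hPQ hPR hQR (hdisj k j hkj) (hPF k) (hQF k) (hRF k) (hPF j)
      (hQF j) (hRF j) (hcov k j hkj) hk hj hcF hc hbF hb hcF' hc' hbF'' hb''
    obtain rfl : d = b' := ((hlist d hdF).resolve_left hdb).resolve_left hdx
    have hRi := ne (hx i) (hRF i)
    have hRk := ne (hx k) (hRF k)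
    have h1 := (isLine_join hRi.symm).eq_of_mem (isLine_join hRk.symm) (ne hdF (hRF j)) hbR
      (left_mem_join _ _) hdR (left_mem_join _ _)
    have h2 := hL.eq_of_mem (isLine_join hRi.symm) (xne hki) (hxL k) (hxL i)
      (h1 ▸ right_mem_join _ _) (right_mem_join _ _)
    exact hRL (h2 ▸ left_mem_join _ _)
  obtain ⟨c'', hcF'', hc''⟩ := hitQR
  have hitPR : ∃ A ∈ F k, A ∈ join P R := by
    by_contra hno
    have hk : ∀ A ∈ F k, A ∉ join P R := fun A hA h => hno ⟨A, hA, h⟩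
    obtain ⟨c, hcF, hc⟩ := (h₁₂ k).resolve_right hno
    obtain ⟨h, -⟩ := collinear_of_cover hL (hF k) (hx i) (hx k)
      (hxL i) (hxL k) hPL hQL hRL hPQR hPQ hPR hQR (hdisj i k hki.symm) (hPF i) (hQF i) (hRF i)
      (hPF k) (hQF k) (hRF k) (hcov i k hki.symm) hi hk haF ha hcF hc haF' ha' hcF'' hc''
    exact hxk h
  obtain ⟨c', hcF', hc'⟩ := hitPR
  -- The same argument with `Q` and `R` interchanged.
  have hitPQ : ∃ A ∈ F k, A ∈ join P Q := by
    by_contra hno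
    have hk : ∀ A ∈ F k, A ∉ join P Q := fun A hA h => hno ⟨A, hA, h⟩
    rw [join_comm Q R] at hi hc''
    obtain ⟨h, -⟩ := collinear_of_cover hL (hF k) (hx i) (hx k)
      (hxL i) (hxL k) hPL hRL hQL hPRQ hPR hPQ hQR.symm (hdisj i k hki.symm) (hPF i) (hRF i) (hQF i)
      (hPF k) (hRF k) (hQF k) (hcov i k hki.symm).swap hi hk haF' ha' hcF' hc' haF ha hcF'' hc''
    exact hxk (join_comm Q R ▸ h)
  obtain ⟨c, hcF, hc⟩ := hitPQ
  have e1 : x k ≠ c := by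
    rintro rfl
    have := hL.eq_of_mem lPQ (ne hcF (hPF k)) (hxL k) hPL hc (left_mem_join _ _)
    exact hQL (this ▸ right_mem_join _ _)
  have e2 : x k ≠ c' := by
    rintro rfl
    have := hL.eq_of_mem lPR (ne hcF' (hPF k)) (hxL k) hPL hc' (left_mem_join _ _)
    exact hRL (this ▸ right_mem_join _ _)
  have e3 : x k ≠ c'' := by
    rintro rfl
    exact hxk hc''
  have e4 : c ≠ c' := by
    rintro rfl
    have := lPQ.eq_of_mem lPR (ne hcF (hPF k)) hc (left_mem_join _ _) hc' (left_mem_join _ _)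
    exact join_ne_join hPQR this
  have e5 : c ≠ c'' := by
    rintro rfl
    have := lPQ.eq_of_mem lQR (ne hcF (hQF k)) hc (right_mem_join _ _) hc'' (left_mem_join _ _)
    exact hPQR (this ▸ right_mem_join _ _)
  have e6 : c' ≠ c'' := by
    rintro rfl
    have := lPR.eq_of_mem lQR (ne hcF' (hRF k)) hc' (right_mem_join _ _) hc'' (right_mem_join _ _)
    exact hPRQ (this ▸ left_mem_join _ _)
  have h4 : ({x k, c, c', c''} : Finset Plane).card = 4 := by
    simp [e1, e2, e3, e4, e5, e6]
  have hs : ({x k, c, c', c''} : Finset Plane) ⊆ F k := by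
    intro Z hZ
    simp only [Finset.mem_insert, Finset.mem_singleton] at hZ
    rcases hZ with rfl | rfl | rfl | rfl
    · exact hx k
    all_goals assumption
  have := Finset.card_le_card hs
  have := hF k
  omega

/-- The node common to two maximal lines of a `GC_3` set has a fundamental polynomial whose three
lines cover the remaining nodes, each line passing through one node of either maximal line. -/
theorem IsGC.exists_cover {Y : Finset Plane} (hY : IsGC 3 Y) {M M' : Set Plane} (hM : IsLine M)
    (hM' : IsLine M') {V : Plane} (hV : V ∈ Y) (hVM : V ∈ M) (hVM' : V ∈ M') {F G : Finset Plane}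
    (hF : ∀ A ∈ F, A ∈ Y ∧ A ∈ M ∧ A ∉ M') (hG : ∀ A ∈ G, A ∈ Y ∧ A ∈ M' ∧ A ∉ M) {P Q R : Plane}
    (hP : P ∈ Y ∧ P ∉ M) (hQ : Q ∈ Y ∧ Q ∉ M) (hR : R ∈ Y ∧ R ∉ M) :
    CoveredByThree F G P Q R := by
  obtain ⟨p, hp⟩ := hY.1.exists_isFundamental hV
  obtain ⟨f, hf, hprod⟩ := hY.2 V hV p hp
  have hVf (s : Fin 3) : V ∉ zeros (f s) := by
    intro h
    have h1 := hp.2.1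
    have h2 : MvPolynomial.eval V (f s) = 0 := h
    rw [hprod, map_prod, Finset.prod_eq_zero (Finset.mem_univ s) h2] at h1
    exact zero_ne_one h1
  have hcov (A : Plane) (hA : A ∈ Y) (hAV : A ≠ V) : ∃ s, A ∈ zeros (f s) := by
    have h1 := hp.2.2 A hA hAV
    rw [hprod, map_prod] at h1
    obtain ⟨s, -, hs⟩ := Finset.prod_eq_zero_iff.1 h1
    exact ⟨s, hs⟩
  have hline (s : Fin 3) : IsLine (zeros (f s)) := ⟨f s, hf s, rfl⟩
  have hinj {N : Set Plane} (hN : IsLine N) (hVN : V ∈ N) (s : Fin 3) {A B : Plane} (hA : A ∈ N)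
      (hB : B ∈ N) (hAs : A ∈ zeros (f s)) (hBs : B ∈ zeros (f s)) : A = B := by
    by_contra hAB
    exact hVf s (hN.eq_of_mem (hline s) hAB hA hB hAs hBs ▸ hVN)
  refine ⟨fun s => zeros (f s), hline, ?_, ?_, ?_, ?_, ?_, ?_, ?_⟩
  · exact fun s A hA B hB h h' => hinj hM hVM s (hF A hA).2.1 (hF B hB).2.1 h h'
  · exact fun s A hA B hB h h' => hinj hM' hVM' s (hG A hA).2.1 (hG B hB).2.1 h h'
  · exact fun A hA => hcov A (hF A hA).1 fun h => (hF A hA).2.2 (h ▸ hVM')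
  · exact fun A hA => hcov A (hG A hA).1 fun h => (hG A hA).2.2 (h ▸ hVM)
  · exact hcov P hP.1 fun h => hP.2 (h ▸ hVM)
  · exact hcov Q hQ.1 fun h => hQ.2 (h ▸ hVM)
  · exact hcov R hR.1 fun h => hR.2 (h ▸ hVM)

theorem dichotomy_four (hGM : ∀ k : ℕ, 1 ≤ k → k ≤ 4 → GascaMaeztu k) {X : Finset Plane}
    (hX : IsGC 4 X) {L : Set Plane} (hL : IsNodeLine 4 X L) : Dichotomy 4 X L := by
  by_contra hno
  simp only [Dichotomy, not_or, not_exists, not_and, not_forall, not_not] at hno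
  obtain ⟨hmeet, hconc⟩ := hno
  rw [isNodeLine_iff] at hL
  obtain ⟨M, hM, hMinj⟩ : ∃ M : Fin 3 → Set Plane, (∀ i, IsMaximalLine 4 X (M i)) ∧
      ∀ i j, i ≠ j → M i ≠ M j := by
    obtain ⟨M₁, M₂, M₃, h₁, h₂, h₃, h₁₂, h₁₃, h₂₃⟩ :=
      hX.exists_three_maximalLines (by norm_num) hGM
    refine ⟨![M₁, M₂, M₃], ?_, ?_⟩
    · intro i; fin_cases i <;> assumption
    · intro i j hij
      fin_cases i <;> fin_cases j <;>
        first | exact absurd rfl hij | assumption | (apply Ne.symm; assumption)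
  have hneL : ∀ i, L ≠ M i := by
    intro i h
    have := (isMaximalLine_iff.1 (hM i)).2
    rw [← h] at this
    omega
  choose x hxX hxM hxL using fun i => hmeet (M i) (hM i)
  have hxM' : ∀ i j, i ≠ j → x i ∉ M j := fun i j hij h =>
    hconc (M i) (M j) (x i) (hM i) (hM j) (hMinj i j hij) (hxX i) (hxM i) h (hxL i)
  have third : ∀ k : Fin 3, ∃ i j : Fin 3, i ≠ j ∧ i ≠ k ∧ j ≠ k := by decide
  have third' : ∀ i j : Fin 3, i ≠ j → ∃ k, i ≠ k ∧ j ≠ k := by decide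
  have Y₁ (i : Fin 3) : IsGC 3 (nodesOff X (M i)) := hX.remove (hM i)
  have M₁ {i j : Fin 3} (hij : i ≠ j) : IsMaximalLine 3 (nodesOff X (M i)) (M j) :=
    hX.1.isMaximalLine_nodesOff (hM i) (hM j) (hMinj i j hij)
  have Y₂ {i j : Fin 3} (hij : i ≠ j) : IsGC 2 (nodesOff (nodesOff X (M i)) (M j)) :=
    (Y₁ i).remove (M₁ hij)
  have M₂ {i j k : Fin 3} (hij : i ≠ j) (hik : i ≠ k) (hjk : j ≠ k) :
      IsMaximalLine 2 (nodesOff (nodesOff X (M i)) (M j)) (M k) :=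
    (Y₁ i).1.isMaximalLine_nodesOff (M₁ hij) (M₁ hik) (hMinj j k hjk)
  -- Removing three maximal lines leaves degree 1: `T` is the triangle `P Q R`. Three of the four
  -- nodes of `L` lie on the `M i`, so exactly one vertex, `P`, lies on `L`.
  set T : Finset Plane := X.filter fun A => ∀ i, A ∉ M i with hT
  have hTeq {i j k : Fin 3} (hij : i ≠ j) (hik : i ≠ k) (hjk : j ≠ k) :
      nodesOff (nodesOff (nodesOff X (M i)) (M j)) (M k) = T := by
    ext A
    simp only [mem_nodesOff, hT, Finset.mem_filter]
    constructor
    · rintro ⟨⟨⟨h, h1⟩, h2⟩, h3⟩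
      refine ⟨h, fun s => ?_⟩
      rcases eq_or_eq_or_eq_of_ne hij hik hjk s with rfl | rfl | rfl <;> assumption
    · exact fun h => ⟨⟨⟨h.1, h.2 i⟩, h.2 j⟩, h.2 k⟩
  have hTGC : IsGC 1 T := by
    have := (Y₂ (i := 0) (j := 1) (by decide)).remove
      (M₂ (k := 2) (by decide) (by decide) (by decide))
    rwa [hTeq (by decide) (by decide) (by decide)] at this
  have hTX {A : Plane} (hA : A ∈ T) : A ∈ X := (Finset.mem_filter.1 hA).1
  have hTM {A : Plane} (hA : A ∈ T) (i : Fin 3) : A ∉ M i := (Finset.mem_filter.1 hA).2 i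
  set F : Fin 3 → Finset Plane := fun i =>
    X.filter fun A => A ∈ M i ∧ ∀ j, j ≠ i → A ∉ M j with hFdef
  have memF {i : Fin 3} {A : Plane} : A ∈ F i ↔ A ∈ X ∧ A ∈ M i ∧ ∀ j, j ≠ i → A ∉ M j := by
    simp [hFdef]
  have hFeq {i j k : Fin 3} (hij : i ≠ j) (hik : i ≠ k) (hjk : j ≠ k) :
      nodesOn (nodesOff (nodesOff X (M i)) (M j)) (M k) = F k := by
    ext A
    simp only [mem_nodesOff, mem_nodesOn, memF]
    constructor
    · rintro ⟨⟨⟨h, h1⟩, h2⟩, h3⟩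
      refine ⟨h, h3, fun s hs => ?_⟩
      rcases eq_or_eq_or_eq_of_ne hij hik hjk s with rfl | rfl | rfl
      · exact h1
      · exact h2
      · exact absurd rfl hs
    · exact fun h => ⟨⟨⟨h.1, h.2.2 i hik⟩, h.2.2 j hjk⟩, h.2.1⟩
  have hFcard (k : Fin 3) : (F k).card = 3 := by
    obtain ⟨i, j, hij, hik, hjk⟩ := third k
    rw [← hFeq hij hik hjk]
    exact (isMaximalLine_iff.1 (M₂ hij hik hjk)).2
  have hxF (i : Fin 3) : x i ∈ F i :=
    memF.2 ⟨hxX i, hxM i, fun j hj => hxM' i j hj.symm⟩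
  have hFdisj (i j : Fin 3) (hij : i ≠ j) : Disjoint (F i) (F j) :=
    Finset.disjoint_left.2 fun A hA hA' => (memF.1 hA').2.2 i hij (memF.1 hA).2.1
  have hTF {A : Plane} (hA : A ∈ T) (i : Fin 3) : A ∉ F i :=
    fun h => hTM hA i (memF.1 h).2.1
  have hTL : (nodesOn T L).card = 1 := by
    have h0 := card_nodesOn_nodesOff_of_mem hL.1 (hM 0).1 (hneL 0) (hxX 0) (hxL 0) (hxM 0)
    have h1 := card_nodesOn_nodesOff_of_mem hL.1 (hM 1).1 (hneL 1)
      (mem_nodesOff.2 ⟨hxX 1, hxM' 1 0 (by decide)⟩) (hxL 1) (hxM 1)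
    have h2 := card_nodesOn_nodesOff_of_mem hL.1 (hM 2).1 (hneL 2)
      (mem_nodesOff.2 ⟨mem_nodesOff.2 ⟨hxX 2, hxM' 2 0 (by decide)⟩, hxM' 2 1 (by decide)⟩)
      (hxL 2) (hxM 2)
    rw [hTeq (by decide) (by decide) (by decide)] at h2
    omega
  obtain ⟨P, hP⟩ := Finset.card_eq_one.1 hTL
  have hPmem : P ∈ nodesOn T L := by simp [hP]
  obtain ⟨hPT, hPL⟩ := mem_nodesOn.1 hPmem
  have honly {A : Plane} (hA : A ∈ T) (hAL : A ∈ L) : A = P := by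
    have : A ∈ nodesOn T L := mem_nodesOn.2 ⟨hA, hAL⟩
    rwa [hP, Finset.mem_singleton] at this
  have hTcard : T.card = 3 :=
    (hTGC.card_eq fun k h1 h2 => hGM k h1 (by omega)).trans (by rfl)
  obtain ⟨Q, R, hQR, hTe⟩ := Finset.card_eq_two.1
    (show (T.erase P).card = 2 by rw [Finset.card_erase_of_mem hPT, hTcard])
  have hQ : Q ∈ T.erase P := by simp [hTe]
  have hR : R ∈ T.erase P := by simp [hTe]
  obtain ⟨hQP, hQT⟩ := Finset.mem_erase.1 hQ
  obtain ⟨hRP, hRT⟩ := Finset.mem_erase.1 hR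
  have hQL : Q ∉ L := fun h => hQP (honly hQT h)
  have hRL : R ∉ L := fun h => hRP (honly hRT h)
  have hPQR := hTGC.1.notMem_join hPT hQT hRT hQP.symm hRP.symm hQR
  have hPRQ := hTGC.1.notMem_join hPT hRT hQT hRP.symm hQP.symm hQR.symm
  have hQRP := hTGC.1.notMem_join hQT hRT hPT hQR hQP hRP
  -- every line `M i` is missed by at most one side of the triangle
  have hmiss {e e' : Set Plane} (he : IsMaximalLine 1 T e) (he' : IsMaximalLine 1 T e')
      (hne : e ≠ e') (k : Fin 3) : (∃ A ∈ F k, A ∈ e) ∨ ∃ A ∈ F k, A ∈ e' := by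
    by_contra! h
    obtain ⟨i, j, hij, hik, hjk⟩ := third k
    rw [← hFeq hij hik hjk] at h
    rw [← hTeq hij hik hjk] at he he'
    exact hne ((Y₂ hij).eq_of_disjoint_maximalLine (M₂ hij hik hjk) he he'
      (fun A hA hAM => h.1 A (mem_nodesOn.2 ⟨hA, hAM⟩))
      (fun A hA hAM => h.2 A (mem_nodesOn.2 ⟨hA, hAM⟩)))
  -- Restoring the `M i` one at a time, a side that meets each `F k` gains a node at every stage.
  have hfull {e : Set Plane} (he : IsMaximalLine 1 T e) (h : ∀ k, ∃ A ∈ F k, A ∈ e) :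
      IsMaximalLine 4 X e := by
    have h01 : (0 : Fin 3) ≠ 1 := by decide
    have h02 : (0 : Fin 3) ≠ 2 := by decide
    have h12 : (1 : Fin 3) ≠ 2 := by decide
    choose z hzF hze using h
    rw [← hTeq h01 h02 h12] at he
    have e2 := (maximalLine_or_disjoint (hM 2).1 he).resolve_right fun hd =>
      hd (z 2) (mem_nodesOff.2 ⟨mem_nodesOff.2 ⟨(memF.1 (hzF 2)).1, (memF.1 (hzF 2)).2.2 0 h02⟩,
        (memF.1 (hzF 2)).2.2 1 h12⟩) (memF.1 (hzF 2)).2.1 (hze 2)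
    have e1 := (maximalLine_or_disjoint (hM 1).1 e2).resolve_right fun hd =>
      hd (z 1) (mem_nodesOff.2 ⟨(memF.1 (hzF 1)).1, (memF.1 (hzF 1)).2.2 0 h01⟩)
        (memF.1 (hzF 1)).2.1 (hze 1)
    exact (maximalLine_or_disjoint (hM 0).1 e1).resolve_right fun hd =>
      hd (z 0) (memF.1 (hzF 0)).1 (memF.1 (hzF 0)).2.1 (hze 0)
  have mPQ := hTGC.1.isMaximalLine_join hPT hQT hQP.symm
  have mPR := hTGC.1.isMaximalLine_join hPT hRT hRP.symm
  have mQR := hTGC.1.isMaximalLine_join hQT hRT hQR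
  have nPQ_PR : join P Q ≠ join P R := join_ne_join hPQR
  have nPQ_QR : join P Q ≠ join Q R := fun h => hPQR (h ▸ right_mem_join _ _)
  have nPR_QR : join P R ≠ join Q R := fun h => hPRQ (h ▸ left_mem_join _ _)
  -- The covering lines come from the fundamental polynomial of the node `V` on `M i` and `M j`,
  -- taken in the degree 3 set left by removing the third line.
  have hcov (i j : Fin 3) (hij : i ≠ j) : CoveredByThree (F i) (F j) P Q R := by
    obtain ⟨k, hik, hjk⟩ := third' i j hij
    obtain ⟨V, hV, hVi, hVj⟩ := (Y₁ k).1.exists_mem_inter (M₁ hik.symm) (M₁ hjk.symm)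
    refine (Y₁ k).exists_cover (hM i).1 (hM j).1 hV hVi hVj (fun A hA => ?_) (fun A hA => ?_)
      ⟨mem_nodesOff.2 ⟨hTX hPT, hTM hPT k⟩, hTM hPT i⟩
      ⟨mem_nodesOff.2 ⟨hTX hQT, hTM hQT k⟩, hTM hQT i⟩
      ⟨mem_nodesOff.2 ⟨hTX hRT, hTM hRT k⟩, hTM hRT i⟩
    · obtain ⟨h1, h2, h3⟩ := memF.1 hA
      exact ⟨mem_nodesOff.2 ⟨h1, h3 k hik.symm⟩, h2, h3 j hij.symm⟩
    · obtain ⟨h1, h2, h3⟩ := memF.1 hA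
      exact ⟨mem_nodesOff.2 ⟨h1, h3 k hjk.symm⟩, h2, h3 i hij⟩
  -- A maximal `Q R` would meet `L` in a node, which is either the vertex `P` or a node on some `M
  -- s`; both are impossible.
  obtain ⟨i, hi⟩ : ∃ i, ∀ A ∈ F i, A ∉ join Q R := by
    by_contra! h
    have hm := hfull mQR h
    obtain ⟨A, hA, hAe, hAL⟩ := hmeet _ hm
    by_cases hAT : A ∈ T
    · exact hQRP (honly hAT hAL ▸ hAe)
    · obtain ⟨s, hs⟩ : ∃ s, A ∈ M s := by
        by_contra! h
        exact hAT (Finset.mem_filter.2 ⟨hA, h⟩)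
      refine hconc _ _ A hm (hM s) (fun he => hTM hQT s (he ▸ left_mem_join _ _)) hA hAe hs hAL
  -- The sides through `P` cannot both be maximal, because they meet on `L`.
  obtain ⟨j, hj⟩ : ∃ j, (∀ A ∈ F j, A ∉ join P Q) ∨ ∀ A ∈ F j, A ∉ join P R := by
    by_contra! h
    exact hconc _ _ P (hfull mPQ fun k => (h k).1) (hfull mPR fun k => (h k).2) nPQ_PR (hTX hPT)
      (left_mem_join _ _) (left_mem_join _ _) hPL
  have a := hmiss mPQ mPR nPQ_PR
  have b := hmiss mPQ mQR nPQ_QR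
  have c := hmiss mPR mQR nPR_QR
  rcases hj with hj | hj
  · rw [join_comm Q R] at hi b c
    exact false_of_sides_miss hL.1 hFcard hFdisj hxF hxL hPL hRL hQL hPRQ hPQR hRP.symm hQP.symm
      hQR.symm (hTF hPT) (hTF hRT) (hTF hQT) (fun i j hij => (hcov i j hij).swap)
      (fun k => (a k).symm) c b hi hj
  · exact false_of_sides_miss hL.1 hFcard hFdisj hxF hxL hPL hQL hRL hPQR hPRQ hQP.symm hRP.symm
      hQR (hTF hPT) (hTF hQT) (hTF hRT) hcov a b c hi hj

/-! ### The dichotomy in general, cardinalities and degree one -/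

theorem dichotomy {n : ℕ} (hn : 1 ≤ n) (hn3 : n ≠ 3)
    (hGM : ∀ k : ℕ, 1 ≤ k → k ≤ n → GascaMaeztu k) {X : Finset Plane} (hX : IsGC n X)
    {L : Set Plane} (hL : IsNodeLine n X L) : Dichotomy n X L := by
  by_cases h2 : n ≤ 2
  · exact dichotomy_of_le_two hn h2 hGM hX hL
  have h4 : 4 ≤ n := by omega
  clear hn hn3 h2
  induction n, h4 using Nat.le_induction generalizing X L with
  | base => exact dichotomy_four hGM hX hL
  | succ n h4 ih =>
    obtain ⟨m, rfl⟩ : ∃ m, n = m + 3 := ⟨n - 3, by omega⟩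
    exact dichotomy_succ (fun Y L' hY hL' => ih (fun k h1 h2 => hGM k h1 (by omega)) hY hL')
      hGM hX hL

theorem card_users_of_disjoint {n : ℕ} (hGM : ∀ k : ℕ, 1 ≤ k → k ≤ n → GascaMaeztu k)
    {X : Finset Plane} (hX : IsGC n X) {L M : Set Plane} (hL : IsNodeLine n X L)
    (hM : IsMaximalLine n X M) (hdisj : ∀ A ∈ X, A ∈ M → A ∉ L) :
    (users n X L).card = n.choose 2 := by
  rw [users_eq_of_disjoint hX.1 hL hM hdisj]
  have h1 := card_nodesOn_add_card_nodesOff X M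
  have h2 := card_nodesOn_add_card_nodesOff (nodesOff X M) L
  rw [nodesOn_nodesOff_of_disjoint fun A hA hAL hAM => hdisj A hA hAM hAL] at h2
  have h3 := hX.card_eq hGM
  have h4 := (isMaximalLine_iff.1 hM).2
  have h5 := (isNodeLine_iff.1 hL).2
  have h6 : (n + 1).choose 2 = n.choose 1 + n.choose 2 := Nat.choose_succ_succ _ _
  have h7 : (n + 2).choose 2 = (n + 1).choose 1 + (n + 1).choose 2 := Nat.choose_succ_succ _ _
  rw [Nat.choose_one_right] at h6 h7
  omega

theorem ne_of_isNodeLine_of_isMaximalLine {n : ℕ} {X : Finset Plane} {L M : Set Plane}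
    (hL : IsNodeLine n X L) (hM : IsMaximalLine n X M) : L ≠ M := by
  rintro rfl
  have h4 := (isMaximalLine_iff.1 hM).2
  have h5 := (isNodeLine_iff.1 hL).2
  omega

/-- Removing two maximal lines that meet at a node of `L` takes exactly one node off `L`. -/
theorem card_nodesOn_of_concurrent {n : ℕ} {X : Finset Plane} {L M M' : Set Plane}
    (hL : IsNodeLine n X L) (hM : IsMaximalLine n X M) (hM' : IsMaximalLine n X M') {A : Plane}
    (hA : A ∈ X) (hAM : A ∈ M) (hAM' : A ∈ M') (hAL : A ∈ L) :
    (nodesOn (nodesOff (nodesOff X M) M') L).card + 1 = n := by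
  have hLM := ne_of_isNodeLine_of_isMaximalLine hL hM
  have hLM' := ne_of_isNodeLine_of_isMaximalLine hL hM'
  rw [nodesOn_nodesOff_of_disjoint (X := nodesOff X M),
    card_nodesOn_nodesOff_of_mem hL.1 hM.1 hLM hA hAL hAM, (isNodeLine_iff.1 hL).2]
  intro B hB hBL hBM'
  refine hLM' (hL.1.eq_of_mem hM'.1 (A := B) (B := A) ?_ hBL hAL hBM' hAM')
  rintro rfl
  exact (mem_nodesOff.1 hB).2 hAM

theorem card_users_of_concurrent {n : ℕ} (hn : 1 ≤ n)
    (hGM : ∀ k : ℕ, 1 ≤ k → k ≤ n → GascaMaeztu k) {X : Finset Plane} (hX : IsGC n X)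
    {L M M' : Set Plane} (hL : IsNodeLine n X L) (hM : IsMaximalLine n X M)
    (hM' : IsMaximalLine n X M') (hne : M ≠ M') {A : Plane} (hA : A ∈ X) (hAM : A ∈ M)
    (hAM' : A ∈ M') (hAL : A ∈ L) : (users n X L).card = (n - 1).choose 2 := by
  rw [users_eq_of_concurrent hX.1 hL hM hM' hne hA hAL hAM hAM']
  have h1 := card_nodesOn_add_card_nodesOff X M
  have h2 := card_nodesOn_add_card_nodesOff (nodesOff X M) M'
  have h3 := card_nodesOn_add_card_nodesOff (nodesOff (nodesOff X M) M') L
  have h4 := card_nodesOn_of_concurrent hL hM hM' hA hAM hAM' hAL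
  have h5 := card_nodesOn_nodesOff_of_mem hM'.1 hM.1 hne.symm hA hAM' hAM
  have h6 := (isMaximalLine_iff.1 hM).2
  have h7 := (isMaximalLine_iff.1 hM').2
  have h8 := hX.card_eq hGM
  obtain ⟨k, rfl⟩ : ∃ k, n = k + 1 := ⟨n - 1, by omega⟩
  have c1 : (k + 1).choose 2 = k.choose 1 + k.choose 2 := Nat.choose_succ_succ _ _
  have c2 : (k + 1 + 1).choose 2 = (k + 1).choose 1 + (k + 1).choose 2 := Nat.choose_succ_succ _ _
  have c3 : (k + 1 + 2).choose 2 = (k + 2).choose 1 + (k + 2).choose 2 := Nat.choose_succ_succ _ _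
  rw [Nat.choose_one_right] at c1 c2 c3
  rw [Nat.add_sub_cancel]
  have c4 : (k + 1 + 1).choose 2 = (k + 2).choose 2 := rfl
  omega

/-- The cardinality identifies the configuration except in degree 1, where both values are 0 and
both configurations must be exhibited. -/
theorem eq_one_of_choose_two_eq {n : ℕ} (hn : 1 ≤ n) (h : n.choose 2 = (n - 1).choose 2) :
    n = 1 := by
  obtain ⟨k, rfl⟩ : ∃ k, n = k + 1 := ⟨n - 1, by omega⟩
  have c1 : (k + 1).choose 2 = k.choose 1 + k.choose 2 := Nat.choose_succ_succ _ _
  rw [Nat.choose_one_right] at c1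
  rw [Nat.add_sub_cancel] at h
  omega

/-- For three nodes and a line through one of them, the side opposite to this node misses the line
and the two other sides meet at the node. -/
theorem exists_maximalLines_of_degree_one (hGM : GascaMaeztu 1) {X : Finset Plane} (hX : IsGC 1 X)
    {L : Set Plane} (hL : IsNodeLine 1 X L) :
    (∃ M, IsMaximalLine 1 X M ∧ ∀ A ∈ X, A ∈ M → A ∉ L) ∧
      ∃ M M' A, IsMaximalLine 1 X M ∧ IsMaximalLine 1 X M' ∧ M ≠ M' ∧ A ∈ X ∧ A ∈ M ∧ A ∈ M' ∧
        A ∈ L := by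
  have hc : X.card = 3 := hX.card_eq fun k h1 h2 => by rwa [le_antisymm h2 h1]
  obtain ⟨P, hP⟩ := Finset.card_eq_one.1 (isNodeLine_iff.1 hL).2
  have hPm : P ∈ nodesOn X L := by simp [hP]
  obtain ⟨hPX, hPL⟩ := mem_nodesOn.1 hPm
  obtain ⟨Q, R, hQR, hXe⟩ := Finset.card_eq_two.1
    (show (X.erase P).card = 2 by rw [Finset.card_erase_of_mem hPX, hc])
  have hQ : Q ∈ X.erase P := by simp [hXe]
  have hR : R ∈ X.erase P := by simp [hXe]
  obtain ⟨hQP, hQX⟩ := Finset.mem_erase.1 hQ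
  obtain ⟨hRP, hRX⟩ := Finset.mem_erase.1 hR
  refine ⟨⟨join Q R, hX.1.isMaximalLine_join hQX hRX hQR, fun A hA hAM hAL => ?_⟩,
    join P Q, join P R, P, hX.1.isMaximalLine_join hPX hQX hQP.symm,
    hX.1.isMaximalLine_join hPX hRX hRP.symm,
    join_ne_join (hX.1.notMem_join hPX hQX hRX hQP.symm hRP.symm hQR), hPX,
    left_mem_join _ _, left_mem_join _ _, hPL⟩
  have : A ∈ nodesOn X L := mem_nodesOn.2 ⟨hA, hAL⟩
  rw [hP, Finset.mem_singleton] at this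
  subst this
  exact hX.1.notMem_join hQX hRX hPX hQR hQP hRP hAM

theorem inter_eq_empty_iff {X : Finset Plane} {L M : Set Plane} :
    M ∩ L ∩ (X : Set Plane) = ∅ ↔ ∀ A ∈ X, A ∈ M → A ∉ L := by
  rw [Set.eq_empty_iff_forall_notMem]
  constructor
  · exact fun h A hA hAM hAL => h A ⟨⟨hAM, hAL⟩, hA⟩
  · exact fun h A hA => h A hA.2 hA.1.1 hA.1.2

theorem inter_eq_singleton {L M M' : Set Plane} (hM : IsLine M) (hM' : IsLine M') (hne : M ≠ M')
    {A : Plane} (hAM : A ∈ M) (hAM' : A ∈ M') (hAL : A ∈ L) : M ∩ M' ∩ L = {A} := by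
  ext B
  rw [Set.mem_singleton_iff]
  constructor
  · rintro ⟨⟨h, h'⟩, -⟩
    by_contra hBA
    exact hne (hM.eq_of_mem hM' hBA h hAM h' hAM')
  · rintro rfl
    exact ⟨⟨hAM, hAM'⟩, hAL⟩

end GCSets

open GCSets in
theorem theorem3p1 (n : ℕ) (hn : 1 ≤ n) (hn3 : n ≠ 3)
    (hGM : ∀ k : ℕ, 1 ≤ k → k ≤ n → GCSets.GascaMaeztu k)
    (X : Finset GCSets.Plane) (hX : GCSets.IsGC n X)
    (L : Set GCSets.Plane) (hL : GCSets.IsNodeLine n X L) :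
    ((GCSets.users n X L).card = n.choose 2 ∨
      (GCSets.users n X L).card = (n - 1).choose 2) ∧
    ((GCSets.users n X L).card = n.choose 2 ↔
      ∃ M₀ : Set GCSets.Plane, GCSets.IsMaximalLine n X M₀ ∧
        M₀ ∩ L ∩ (X : Set GCSets.Plane) = ∅) ∧
    (∀ M₀ : Set GCSets.Plane, GCSets.IsMaximalLine n X M₀ →
      M₀ ∩ L ∩ (X : Set GCSets.Plane) = ∅ →
        (GCSets.users n X L : Set GCSets.Plane) = (X : Set GCSets.Plane) \ (L ∪ M₀) ∧
        (2 ≤ n → GCSets.IsGC (n - 2) (GCSets.users n X L))) ∧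
    ((GCSets.users n X L).card = (n - 1).choose 2 ↔
      ∃ M' M'' : Set GCSets.Plane, GCSets.IsMaximalLine n X M' ∧
        GCSets.IsMaximalLine n X M'' ∧ M' ≠ M'' ∧
        ∃ A ∈ X, M' ∩ M'' ∩ L = {A}) ∧
    (∀ M' M'' : Set GCSets.Plane, GCSets.IsMaximalLine n X M' →
      GCSets.IsMaximalLine n X M'' → M' ≠ M'' →
      (∃ A ∈ X, M' ∩ M'' ∩ L = {A}) →
        (GCSets.users n X L : Set GCSets.Plane) =
          (X : Set GCSets.Plane) \ (L ∪ M' ∪ M'') ∧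
        (3 ≤ n → GCSets.IsGC (n - 3) (GCSets.users n X L))) := by
  have hdich := dichotomy hn hn3 hGM hX hL
  have hmem {M' M'' : Set Plane} {A : Plane} (h : M' ∩ M'' ∩ L = {A}) :
      A ∈ M' ∧ A ∈ M'' ∧ A ∈ L := by
    have : A ∈ M' ∩ M'' ∩ L := by rw [h]; rfl
    exact ⟨this.1.1, this.1.2, this.2⟩
  have hcard₁ (M : Set Plane) (hM : IsMaximalLine n X M) (hd : ∀ A ∈ X, A ∈ M → A ∉ L) :=
    card_users_of_disjoint hGM hX hL hM hd
  have hcard₂ (M M' : Set Plane) (A : Plane) (hM : IsMaximalLine n X M)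
      (hM' : IsMaximalLine n X M') (hne : M ≠ M') (hA : A ∈ X) (hAM : A ∈ M) (hAM' : A ∈ M')
      (hAL : A ∈ L) := card_users_of_concurrent hn hGM hX hL hM hM' hne hA hAM hAM' hAL
  refine ⟨?_, ⟨fun h => ?_, ?_⟩, ?_, ⟨fun h => ?_, ?_⟩, ?_⟩
  · rcases hdich with ⟨M, hM, hd⟩ | ⟨M, M', A, hM, hM', hne, hA, h1, h2, h3⟩
    · exact Or.inl (hcard₁ M hM hd)
    · exact Or.inr (hcard₂ M M' A hM hM' hne hA h1 h2 h3)
  · simp only [inter_eq_empty_iff]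
    rcases hdich with hd | ⟨M, M', A, hM, hM', hne, hA, h1, h2, h3⟩
    · exact hd
    · obtain rfl := eq_one_of_choose_two_eq hn
        (h.symm.trans (hcard₂ M M' A hM hM' hne hA h1 h2 h3))
      exact (exists_maximalLines_of_degree_one (hGM 1 le_rfl le_rfl) hX hL).1
  · rintro ⟨M, hM, hd⟩
    exact hcard₁ M hM (inter_eq_empty_iff.1 hd)
  · intro M hM hd
    rw [inter_eq_empty_iff] at hd
    rw [users_eq_of_disjoint hX.1 hL hM hd]
    refine ⟨?_, fun h2 => ?_⟩
    · ext A
      simp only [Finset.mem_coe, mem_nodesOff, Set.mem_sdiff, Set.mem_union]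
      tauto
    · obtain ⟨k, rfl⟩ : ∃ k, n = k + 2 := ⟨n - 2, by omega⟩
      -- `L` keeps its `n` nodes while the degree drops to `n - 1`, so it has become maximal.
      refine (hX.remove hM).remove (isMaximalLine_iff.2 ⟨hL.1, ?_⟩)
      rw [nodesOn_nodesOff_of_disjoint fun A hA hAL hAM => hd A hA hAM hAL,
        (isNodeLine_iff.1 hL).2]
  · have hex : ∃ M M' A, IsMaximalLine n X M ∧ IsMaximalLine n X M' ∧ M ≠ M' ∧ A ∈ X ∧ A ∈ M ∧
        A ∈ M' ∧ A ∈ L := by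
      rcases hdich with ⟨M, hM, hd⟩ | hc
      · obtain rfl := eq_one_of_choose_two_eq hn ((hcard₁ M hM hd).symm.trans h)
        exact (exists_maximalLines_of_degree_one (hGM 1 le_rfl le_rfl) hX hL).2
      · exact hc
    obtain ⟨M, M', A, hM, hM', hne, hA, h1, h2, h3⟩ := hex
    exact ⟨M, M', hM, hM', hne, A, hA, inter_eq_singleton hM.1 hM'.1 hne h1 h2 h3⟩
  · rintro ⟨M, M', hM, hM', hne, A, hA, h⟩
    obtain ⟨h1, h2, h3⟩ := hmem h
    exact hcard₂ M M' A hM hM' hne hA h1 h2 h3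
  · rintro M M' hM hM' hne ⟨A, hA, h⟩
    obtain ⟨h1, h2, h3⟩ := hmem h
    rw [users_eq_of_concurrent hX.1 hL hM hM' hne hA h3 h1 h2]
    refine ⟨?_, fun hn3 => ?_⟩
    · ext A
      simp only [Finset.mem_coe, mem_nodesOff, Set.mem_sdiff, Set.mem_union]
      tauto
    · obtain ⟨k, rfl⟩ : ∃ k, n = k + 3 := ⟨n - 3, by omega⟩
      have hc := card_nodesOn_of_concurrent hL hM hM' hA h1 h2 h3
      exact ((hX.remove hM).remove (hX.1.isMaximalLine_nodesOff hM hM' hne)).remove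
        (isMaximalLine_iff.2 ⟨hL.1, by omega⟩)
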